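/- Let $A(s,t)$, for positive integers $s,t$, be the Ackermann function given by $A(1,t)=2t$, $A(s,1)=2$ and $A(s,t)=A(s-1,A(s,t-1))$ for $s,t>1$, and let $\alpha(n)=\min\{s\ge 1 : A(s,s)\ge n\}$ be its inverse. A polytopal $3$-complex is a finite collection $Q$ of convex polytopes in $\mathbb{R}^3$ that contains the empty set, contains every face of each of its members, and in which the intersection of any two members is a (possibly empty) face of both. Let $f_k(Q)$ be the number of $k$-dimensional members of $Q$; the $0$-dimensional ones are the vertices of $Q$ and the $3$-dimensional ones its facets. Let $f_{03}(Q)$ be the number of pairs (vertex, facet) such that the vertex lies in the facet, and let the complexity of $Q$ be $\mathcal{C}(Q)=\dfrac{f_{03}(Q)-20}{f_0(Q)+f_3(Q)-10}$. A binary matrix $M$ contains a binary matrix $N$ if $N$ can be obtained from $M$ by deleting rows, deleting columns and changing some ones to zeros; otherwise $M$ avoids $N$. Let $x(t)=(t,t^2,t^3)$ be the moment curve in $\mathbb{R}^3$. **Theorem.** For arbitrarily large $n$ there exist polytopal $3$-complexes $Q$ such that $f_0(Q),f_3(Q)\le n$ and $f_{03}(Q)=\Theta(n\,\alpha(n))$;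 in particular the complexity of polytopal $3$-complexes is unbounded. Moreover, $Q$ can be chosen from $n\times n$ binary matrices that avoid $\begin{bmatrix}0&1&0&1\\1&0&1&0\end{bmatrix}$ and have $\Theta(n\,\alpha(n))$ ones. Precisely: there are constants $c,C>0$ such that for all $n_0\in\mathbb{N}$ and $K\in\mathbb{R}$ there exist an integer $n\ge n_0$, an $n\times n$ binary matrix $M$ and a polytopal $3$-complex $Q$ such that 1. $M$ avoids $\begin{bmatrix}0&1&0&1\\1&0&1&0\end{bmatrix}$, and the number $|M|$ of ones of $M$ satisfies $c\,n\,\alpha(n)\le |M|\le C\,n\,\alpha(n)$; 2. $Q$ consists of the polytopes $P_i=\operatorname{conv}\{x(j) : M_{ij}=1\}$, where $i$ runs over the rows of $M$ with at least four ones, and of all faces of these polytopes; the map $i\mapsto P_i$ is a bijection from the set of these rows to the set of facets of $Q$; 3. $f_0(Q)\le n$, $f_3(Q)\le n$ and $c\,n\,\alpha(n)\le f_{03}(Q)\le C\,n\,\alpha(n)$; 4. $\mathcal{C}(Q)>K$. -/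

import Mathlib

/-! ### The Ackermann function and its inverse -/

/-- The Ackermann function for positive integers `s`, `t`: `A(1,t) = 2t`, `A(s,1) = 2` and
`A(s,t) = A(s-1, A(s,t-1))` for `s, t > 1`.  (The value is `0` when an argument is `0`.) -/
def ackermannFn : ℕ → ℕ → ℕ
  | 0, _ => 0
  | 1, t => 2 * t
  | _ + 2, 0 => 0
  | _ + 2, 1 => 2
  | s + 2, t + 2 => ackermannFn (s + 1) (ackermannFn (s + 2) (t + 1))
termination_by s t => (s, t)

/-- The inverse Ackermann function `α(n) = min {s ≥ 1 | A(s,s) ≥ n}`. -/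
noncomputable def inverseAckermann (n : ℕ) : ℕ :=
  sInf {s : ℕ | 1 ≤ s ∧ n ≤ ackermannFn s s}

/-! ### Binary matrices and pattern avoidance -/

/-- The number of ones of a binary matrix. -/
def matrixWeight {m n : ℕ} (M : Matrix (Fin m) (Fin n) Bool) : ℕ :=
  (Finset.univ.filter fun p : Fin m × Fin n => M p.1 p.2 = true).card

/-- The number of ones in row `i` of a binary matrix. -/
def rowWeight {m n : ℕ} (M : Matrix (Fin m) (Fin n) Bool) (i : Fin m) : ℕ :=
  (Finset.univ.filter fun j : Fin n => M i j = true).card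

/-- `M` contains `N`: one obtains `N` from `M` by deleting rows and columns and changing
some ones to zeros. -/
def MatrixContains {m n a b : ℕ} (M : Matrix (Fin m) (Fin n) Bool)
    (N : Matrix (Fin a) (Fin b) Bool) : Prop :=
  ∃ (r : Fin a ↪o Fin m) (c : Fin b ↪o Fin n), ∀ i j, N i j = true → M (r i) (c j) = true

/-- The `2 × 4` pattern with rows `0101` and `1010`. -/
def alternatingPattern : Matrix (Fin 2) (Fin 4) Bool :=
  !![false, true, false, true; true, false, true, false]

/-! ### Polytopes and polytopal complexes -/

/-- A polytope in `ℝ^d` (of any dimension): the convex hull of finitely many points.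
The empty set is a polytope. -/
def IsPolytope {d : ℕ} (P : Set (EuclideanSpace ℝ (Fin d))) : Prop :=
  ∃ s : Finset (EuclideanSpace ℝ (Fin d)), P = convexHull ℝ (s : Set (EuclideanSpace ℝ (Fin d)))

/-- `F` is a face of the polytope `P`: it is empty, or it is the set of all points of `P` at which
some linear functional attains its maximum over `P`.  The zero functional gives `P` itself, and the
nonzero ones give the intersections of `P` with its supporting hyperplanes. -/
def IsPolytopeFace {d : ℕ} (P F : Set (EuclideanSpace ℝ (Fin d))) : Prop :=
  IsExposed ℝ P F

/-- The polytope `P` has dimension `k ≥ 0`.  The empty polytope has dimension `-1`, hence it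
has no dimension in this sense. -/
def HasPolytopeDim {d : ℕ} (P : Set (EuclideanSpace ℝ (Fin d))) (k : ℕ) : Prop :=
  P.Nonempty ∧ Module.finrank ℝ (vectorSpan ℝ P) = k

/-- A (finite) polytopal `d`-complex. -/
structure PolytopalComplex (d : ℕ) where
  /-- the polytopes of the complex -/
  faces : Set (Set (EuclideanSpace ℝ (Fin d)))
  finite_faces : faces.Finite
  isPolytope : ∀ P ∈ faces, IsPolytope P
  empty_mem : ∅ ∈ faces
  face_mem : ∀ P ∈ faces, ∀ F, IsPolytopeFace P F → F ∈ faces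
  inter_isFace : ∀ P ∈ faces, ∀ P' ∈ faces,
    IsPolytopeFace P (P ∩ P') ∧ IsPolytopeFace P' (P ∩ P')

namespace PolytopalComplex

/-- The set of `k`-faces of a polytopal `d`-complex.  The `0`-faces are the vertices (as
one-point sets) and the `d`-faces are the facets. -/
def kFaces {d : ℕ} (Q : PolytopalComplex d) (k : ℕ) : Set (Set (EuclideanSpace ℝ (Fin d))) :=
  {F ∈ Q.faces | HasPolytopeDim F k}

/-- `f_k(Q)`, the number of `k`-faces. -/
noncomputable def fNum {d : ℕ} (Q : PolytopalComplex d) (k : ℕ) : ℕ :=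
  (Q.kFaces k).ncard

/-- The number of vertex-facet incidences of a polytopal `d`-complex (`f_{03}` when `d = 3`). -/
noncomputable def vertexFacetIncidences {d : ℕ} (Q : PolytopalComplex d) : ℕ :=
  {p : Set (EuclideanSpace ℝ (Fin d)) × Set (EuclideanSpace ℝ (Fin d)) |
    p.1 ∈ Q.kFaces 0 ∧ p.2 ∈ Q.kFaces d ∧ p.1 ⊆ p.2}.ncard

/-- The complexity `(f_{03} - 20) / (f_0 + f_3 - 10)` of a polytopal `3`-complex. -/
noncomputable def complexity (Q : PolytopalComplex 3) : ℝ :=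
  ((Q.vertexFacetIncidences : ℝ) - 20) / ((Q.fNum 0 : ℝ) + (Q.fNum 3 : ℝ) - 10)

end PolytopalComplex

/-! ### Polytopes on the moment curve -/

/-- The moment curve `x(t) = (t, t^2, …, t^d)` in `ℝ^d`. -/
noncomputable def momentCurve (d : ℕ) (t : ℝ) : EuclideanSpace ℝ (Fin d) :=
  WithLp.toLp 2 fun i : Fin d => t ^ ((i : ℕ) + 1)

/-- The polytope `conv {x(j) | M_{ij} = 1}` in `ℝ^3` of row `i`; columns are numbered from `1`. -/
noncomputable def rowPolytope {m n : ℕ} (M : Matrix (Fin m) (Fin n) Bool) (i : Fin m) :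
    Set (EuclideanSpace ℝ (Fin 3)) :=
  convexHull ℝ ((fun j : Fin n => momentCurve 3 (((j : ℕ) : ℝ) + 1)) '' {j | M i j = true})

/-! ### Growth of the fan numbers and the Ackermann function -/

/-- Numbers of fan columns in the recursive construction of dense matrices. -/
def fanCount : ℕ → ℕ → ℕ
  | 0, _ => 2
  | _ + 1, 0 => 4
  | k + 1, m + 1 => fanCount (k + 1) m * fanCount k (fanCount (k + 1) m)
termination_by k m => (k, m)

theorem two_le_fanCount (k m : ℕ) : 2 ≤ fanCount k m := by
  induction k generalizing m with
  | zero => simp [fanCount]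
  | succ k ih =>
    induction m with
    | zero => simp [fanCount]
    | succ m ihm =>
      rw [fanCount]
      nlinarith [ih (fanCount (k + 1) m)]

theorem two_pow_le_fanCount (k m : ℕ) : 4 * 2 ^ m ≤ fanCount (k + 1) m := by
  induction m with
  | zero => simp [fanCount]
  | succ m ih =>
    rw [fanCount, pow_succ, ← mul_assoc]
    exact Nat.mul_le_mul ih (two_le_fanCount k _)

theorem ackermannFn_one_left (t : ℕ) : ackermannFn 1 t = 2 * t := by
  rw [ackermannFn]

theorem ackermannFn_one_right (s : ℕ) : ackermannFn (s + 1) 1 = 2 := by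
  cases s <;> simp [ackermannFn]

theorem ackermannFn_zero_right (s : ℕ) : ackermannFn (s + 1) 0 = 0 := by
  cases s <;> simp [ackermannFn]

theorem ackermannFn_succ_succ (s t : ℕ) (ht : 1 ≤ t) :
    ackermannFn (s + 2) (t + 1) = ackermannFn (s + 1) (ackermannFn (s + 2) t) := by
  obtain ⟨t, rfl⟩ := Nat.exists_eq_add_of_le' ht
  rw [ackermannFn]

theorem two_mul_le_ackermannFn (s t : ℕ) : 2 * t ≤ ackermannFn (s + 1) t := by
  induction s generalizing t with
  | zero => rw [ackermannFn_one_left]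
  | succ s ih =>
    induction t with
    | zero => simp
    | succ t iht =>
      rcases Nat.eq_zero_or_pos t with rfl | ht
      · simp [ackermannFn_one_right]
      · rw [ackermannFn_succ_succ s t ht]
        have := ih (ackermannFn (s + 2) t)
        change 2 * t ≤ ackermannFn (s + 2) t at iht
        omega

theorem ackermannFn_two_right (s : ℕ) : ackermannFn (s + 1) 2 = 4 := by
  induction s with
  | zero => simp [ackermannFn_one_left]
  | succ s ih => rw [ackermannFn_succ_succ s 1 le_rfl, ackermannFn_one_right, ih]

theorem two_mul_ackermannFn_le (s t : ℕ) (ht : 1 ≤ t) :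
    2 * ackermannFn (s + 2) t ≤ ackermannFn (s + 2) (t + 1) := by
  rw [ackermannFn_succ_succ s t ht]
  exact two_mul_le_ackermannFn s _

theorem ackermannFn_mono (s : ℕ) : Monotone (ackermannFn (s + 1)) := by
  refine monotone_nat_of_le_succ fun t => ?_
  rcases Nat.eq_zero_or_pos t with rfl | ht
  · simp [ackermannFn_zero_right]
  · cases s with
    | zero => simp [ackermannFn_one_left]
    | succ s => exact (Nat.le_mul_of_pos_left _ two_pos).trans (two_mul_ackermannFn_le s t ht)

theorem two_pow_mul_ackermannFn_le (s t d : ℕ) (ht : 1 ≤ t) :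
    2 ^ d * ackermannFn (s + 2) t ≤ ackermannFn (s + 2) (t + d) := by
  induction d with
  | zero => simp
  | succ d ih =>
    have := two_mul_ackermannFn_le s (t + d) (by omega)
    rw [← add_assoc, pow_succ]
    linarith

theorem le_ackermannFn_add_three (s x : ℕ) (hx : 3 ≤ x) : 2 * x + 4 ≤ ackermannFn (s + 3) x := by
  induction x, hx using Nat.le_induction with
  | base =>
    rw [ackermannFn_succ_succ (s + 1) 2 (by omega), ackermannFn_two_right,
      ackermannFn_succ_succ s 3 (by omega), ackermannFn_succ_succ s 2 (by omega),
      ackermannFn_two_right]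
    have h1 := two_mul_le_ackermannFn s 4
    have h2 := two_mul_le_ackermannFn s (ackermannFn (s + 1) 4)
    omega
  | succ x hx ih => have := two_mul_ackermannFn_le (s + 1) x (by omega); grind

/-- Each step in `k` costs two Ackermann levels. The recursion in `m` iterates `f ↦ f * fanCount k
f`, which is bounded by level `2k + 1`, so it is bounded by level `2k + 2` with argument shifted by
2. Level `2k + 3` then absorbs the shift and the extra factor `x`. -/
theorem mul_fanCount_le_ackermannFn (k x : ℕ) (hx : 4 ≤ x) :
    x * fanCount k x ≤ ackermannFn (2 * k + 1) x := by
  induction k generalizing x with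
  | zero => simp [fanCount, ackermannFn_one_left, mul_comm]
  | succ k ih =>
    have hF : ∀ m, fanCount (k + 1) m ≤ ackermannFn (2 * k + 2) (m + 2) := by
      intro m
      induction m with
      | zero => simp [fanCount, ackermannFn_two_right]
      | succ m ihm =>
        rw [fanCount, show m + 1 + 2 = m + 2 + 1 by ring, ackermannFn_succ_succ _ _ (by omega)]
        refine (ih _ ?_).trans (ackermannFn_mono _ ihm)
        have := two_pow_le_fanCount k m
        have := Nat.one_le_two_pow (n := m)
        omega
    obtain ⟨y, rfl⟩ : ∃ y, x = y + 1 := ⟨x - 1, by omega⟩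
    rw [show 2 * (k + 1) + 1 = 2 * k + 1 + 2 by ring, ackermannFn_succ_succ _ _ (by omega)]
    calc (y + 1) * fanCount (k + 1) (y + 1)
        ≤ 2 ^ (y + 1) * ackermannFn (2 * k + 2) (y + 1 + 2) :=
          Nat.mul_le_mul Nat.lt_two_pow_self.le (hF _)
      _ ≤ ackermannFn (2 * k + 2) (y + 1 + 2 + (y + 1)) :=
          two_pow_mul_ackermannFn_le _ _ _ (by omega)
      _ ≤ _ := ackermannFn_mono _ (by
          have := le_ackermannFn_add_three (2 * k) y (by omega)
          show _ ≤ ackermannFn (2 * k + 3) y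
          omega)

theorem inverseAckermann_mul_fanCount_le (k : ℕ) (hk : 2 ≤ k) :
    inverseAckermann (4 * fanCount k 4) ≤ 2 * k + 1 :=
  Nat.sInf_le ⟨by omega,
    -- The diagonal value dominates because `4 ≤ 2 * k + 1`; this is where `2 ≤ k` enters.
    (mul_fanCount_le_ackermannFn k 4 le_rfl).trans (ackermannFn_mono _ (by omega))⟩

theorem inverseAckermann_spec (k : ℕ) (hk : 2 ≤ k) :
    1 ≤ inverseAckermann (4 * fanCount k 4) ∧ 4 * fanCount k 4 ≤
      ackermannFn (inverseAckermann (4 * fanCount k 4)) (inverseAckermann (4 * fanCount k 4)) :=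
  Nat.sInf_mem (s := {s : ℕ | 1 ≤ s ∧ 4 * fanCount k 4 ≤ ackermannFn s s}) ⟨2 * k + 1, by omega,
    (mul_fanCount_le_ackermannFn k 4 le_rfl).trans (ackermannFn_mono _ (by omega))⟩

/-- If the inverse were below `N`, the argument would be at most one of the finitely many diagonal
values `A(s,s)` with `s < N`. -/
theorem exists_le_inverseAckermann (N : ℕ) : ∃ n₁, ∀ k, 2 ≤ k → n₁ ≤ 4 * fanCount k 4 →
    N ≤ inverseAckermann (4 * fanCount k 4) := by
  refine ⟨(Finset.range N).sup (fun s => ackermannFn s s) + 1, fun k hk h => ?_⟩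
  by_contra! hlt
  have h1 := (inverseAckermann_spec k hk).2
  have h2 := Finset.le_sup (f := fun s => ackermannFn s s) (Finset.mem_range.2 hlt)
  omega

/-! ### Recursive construction of dense avoiding matrices -/

theorem exists_strictMonoOn_bijOn {α β : Type*} [LinearOrder α] [LinearOrder β] [Nonempty β]
    (s : Finset α) (t : Finset β) (h : s.card = t.card) :
    ∃ f : α → β, StrictMonoOn f s ∧ Set.BijOn f s t := by
  classical
  let e : s ≃o t := (s.orderIsoOfFin h).symm.trans (t.orderIsoOfFin rfl)
  refine ⟨fun x => if hx : x ∈ s then e ⟨x, hx⟩ else Classical.arbitrary β, ?_, ?_, ?_, ?_⟩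
  · intro x hx y hy hxy
    have hx' : x ∈ s := hx
    have hy' : y ∈ s := hy
    simpa [hx', hy'] using hxy
  · intro x hx
    have hx' : x ∈ s := hx
    simp [hx']
  · intro x hx y hy hxy
    have hx' : x ∈ s := hx
    have hy' : y ∈ s := hy
    simpa [hx', hy', Subtype.ext_iff] using hxy
  · intro y hy
    refine ⟨e.symm ⟨y, hy⟩, (e.symm ⟨y, hy⟩).2, ?_⟩
    simp

/-- A binary matrix (with ordered sets of rows and columns) that avoids the alternating pattern,
has `k` ones in each row, and has a set of `F` fan columns.  Each fan column consists of the first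
ones of exactly `m` rows, and every row starts in a fan column.  If two rows start in the same fan
column, then all the other ones of the upper row precede those of the lower row. -/
structure FanMatrix (k m F : ℕ) where
  R : Type
  C : Type
  [ordR : LinearOrder R]
  [ordC : LinearOrder C]
  rows : Finset R
  cols : Finset C
  fans : Finset C
  first : R → C
  E : R → C → Prop
  mem_rows : ∀ r c, E r c → r ∈ rows
  mem_cols : ∀ r c, E r c → c ∈ cols
  fans_subset : fans ⊆ cols
  card_fans : fans.card = F
  first_mem : ∀ r ∈ rows, first r ∈ fans
  E_first : ∀ r ∈ rows, E r (first r)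
  first_le : ∀ r c, E r c → first r ≤ c
  eq_first : ∀ r c, E r c → c ∈ fans → c = first r
  card_fan : ∀ c ∈ fans, Set.ncard {r | r ∈ rows ∧ first r = c} = m
  card_row : ∀ r ∈ rows, Set.ncard {c | E r c} = k
  avoids : ∀ a b c₀ c₁ c₂ c₃, a < b → c₀ < c₁ → c₁ < c₂ → c₂ < c₃ →
    E b c₀ → E a c₁ → E b c₂ → E a c₃ → False
  fan_lt : ∀ a b c d, a < b → first a = first b → E a c → E b d → first a < c → first b < d → c < d

namespace FanMatrix

attribute [instance] ordR ordC

variable {k m F : ℕ}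

theorem finite_row (T : FanMatrix k m F) (r : T.R) : {c | T.E r c}.Finite :=
  T.cols.finite_toSet.subset fun c hc => T.mem_cols r c hc

theorem card_rows (T : FanMatrix k m F) : T.rows.card = F * m := by
  classical
  rw [Finset.card_eq_sum_card_fiberwise (f := T.first) (t := T.fans) fun r hr => T.first_mem r hr,
    Finset.sum_const_nat (m := m), T.card_fans]
  intro c hc
  refine Eq.trans ?_ (T.card_fan c hc)
  rw [← Set.ncard_coe_finset]
  congr 1
  ext r
  simp

/-- The matrix with `F` empty fan columns. -/
def empty (k F : ℕ) : FanMatrix k 0 F where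
  R := Empty
  C := Fin F
  rows := ∅
  cols := Finset.univ
  fans := Finset.univ
  first := Empty.elim
  E := fun _ _ => False
  mem_rows := by simp
  mem_cols := by simp
  fans_subset := by simp
  card_fans := by simp
  first_mem := by simp
  E_first := by simp
  first_le := by simp
  eq_first := by simp
  card_fan := by simp
  card_row := by simp
  avoids := by simp
  fan_lt := by simp

/-- The matrix with one one in each row, all columns being fan columns. -/
def single (m F : ℕ) : FanMatrix 1 m F where
  R := Fin F ×ₗ Fin m
  C := Fin F
  rows := Finset.univ
  cols := Finset.univ
  fans := Finset.univ
  first := fun r => (ofLex r).1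
  E := fun r c => c = (ofLex r).1
  mem_rows := by simp
  mem_cols := by simp
  fans_subset := by simp
  card_fans := by simp
  first_mem := by simp
  E_first := by simp
  first_le := by rintro r c rfl; exact le_rfl
  eq_first := by rintro r c rfl _; rfl
  card_fan := by
    intro c _
    have : {r : Fin F ×ₗ Fin m | r ∈ Finset.univ ∧ (ofLex r).1 = c} =
        (fun j => toLex (c, j)) '' Set.univ := by
      ext r
      constructor
      · rintro ⟨-, rfl⟩
        exact ⟨(ofLex r).2, trivial, rfl⟩
      · rintro ⟨j, -, rfl⟩
        simp
    rw [this, Set.ncard_image_of_injective, Set.ncard_univ, Nat.card_eq_fintype_card,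
      Fintype.card_fin]
    intro i j hij
    simpa using hij
  card_row := by simp
  avoids := by
    rintro a b c₀ c₁ c₂ c₃ - h1 h2 - rfl rfl h -
    exact absurd (h1.trans h2) (by rw [h]; exact lt_irrefl _)
  fan_lt := by
    rintro a b c d - - rfl _ h
    exact absurd h (lt_irrefl _)

section Shuffle

variable {m' F' : ℕ} (S : FanMatrix k m' F') (T : FanMatrix (k + 1) m F) (idx : S.R → T.C)

/-- The ones of the matrix obtained from `S` by inserting a copy of `T` before each fan column and
adding a one in the fan column `idx r` of the appropriate copy to each row `r` of `S`. -/
def shuffleE : (S.C ×ₗ T.R) ⊕ S.R → S.C × WithTop T.C → Prop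
  | Sum.inl p, c => (ofLex p).1 ∈ S.fans ∧ c.1 = (ofLex p).1 ∧ ∃ y : T.C, c.2 = y ∧ T.E (ofLex p).2 y
  | Sum.inr r, c => (c.2 = ⊤ ∧ S.E r c.1) ∨ (r ∈ S.rows ∧ c.1 = S.first r ∧ c.2 = idx r)

/-- The first ones of the rows of the matrix `shuffleE`. -/
def shuffleFirst : (S.C ×ₗ T.R) ⊕ S.R → S.C × WithTop T.C
  | Sum.inl p => ((ofLex p).1, (T.first (ofLex p).2 : WithTop T.C))
  | Sum.inr r => (S.first r, (idx r : WithTop T.C))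

variable {S T idx}

theorem shuffleE_inr_fst {r : S.R} {c : S.C × WithTop T.C} (h : shuffleE S T idx (Sum.inr r) c) :
    S.E r c.1 := by
  obtain ⟨-, h⟩ | ⟨hr, h, -⟩ := h
  · exact h
  · rw [h]
    exact S.E_first r hr

theorem shuffleE_inr_of_ne {r : S.R} {c : S.C × WithTop T.C}
    (h : shuffleE S T idx (Sum.inr r) c) (hc : c.2 ≠ ⊤) :
    r ∈ S.rows ∧ c.1 = S.first r ∧ c.2 = idx r := by
  obtain ⟨h, -⟩ | h := h
  · exact absurd h hc
  · exact h

theorem shuffleE_first_le {r : (S.C ×ₗ T.R) ⊕ S.R} {c : S.C × WithTop T.C}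
    (h : shuffleE S T idx r c) : toLex (shuffleFirst S T idx r) ≤ toLex c := by
  rw [Prod.Lex.toLex_le_toLex]
  rcases r with p | r
  · obtain ⟨-, h1, y, h2, h⟩ := h
    refine Or.inr ⟨h1.symm, ?_⟩
    rw [h2]
    exact WithTop.coe_le_coe.2 (T.first_le _ _ h)
  · obtain ⟨h1, h⟩ | ⟨-, h1, h2⟩ := h
    · rcases (S.first_le _ _ h).lt_or_eq with h' | h'
      · exact Or.inl h'
      · exact Or.inr ⟨h', h1 ▸ le_top⟩
    · exact Or.inr ⟨h1.symm, h2.ge⟩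

theorem shuffleE_eq_first {r : (S.C ×ₗ T.R) ⊕ S.R} {φ : S.C} {y : T.C}
    (h : shuffleE S T idx r (φ, (y : WithTop T.C))) (hy : y ∈ T.fans) :
    (φ, (y : WithTop T.C)) = shuffleFirst S T idx r := by
  rcases r with p | r
  · obtain ⟨-, h1, z, h2, h⟩ := h
    obtain rfl : y = z := WithTop.coe_injective h2
    exact Prod.ext h1 (congrArg (fun z : T.C => (z : WithTop T.C)) (T.eq_first _ _ h hy))
  · obtain ⟨-, h1, h2⟩ := shuffleE_inr_of_ne h (WithTop.coe_ne_top)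
    exact Prod.ext h1 h2

/-- All rows from copies of `T` lie above all rows of `S`. Within a fan of `S`, monotonicity of
`idx` places the new ones in the order of the rows, which is what keeps two such rows from
alternating. -/
theorem shuffleE_avoids
    (hidx : ∀ φ ∈ S.fans, StrictMonoOn idx {r | r ∈ S.rows ∧ S.first r = φ})
    (a b : (S.C ×ₗ T.R) ⊕ S.R) (c₀ c₁ c₂ c₃ : S.C × WithTop T.C)
    (hab : toLex a < toLex b) (h₀ : toLex c₀ < toLex c₁) (h₁ : toLex c₁ < toLex c₂)
    (h₂ : toLex c₂ < toLex c₃) (e₀ : shuffleE S T idx b c₀) (e₁ : shuffleE S T idx a c₁)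
    (e₂ : shuffleE S T idx b c₂) (e₃ : shuffleE S T idx a c₃) : False := by
  obtain ⟨p₀, q₀⟩ := c₀
  obtain ⟨p₁, q₁⟩ := c₁
  obtain ⟨p₂, q₂⟩ := c₂
  obtain ⟨p₃, q₃⟩ := c₃
  rw [Prod.Lex.toLex_lt_toLex] at h₀ h₁ h₂
  simp only at h₀ h₁ h₂
  rcases a with a | a <;> rcases b with b | b
  · rw [Sum.Lex.inl_lt_inl_iff, Prod.Lex.lt_iff] at hab
    obtain ⟨-, f₀, y₀, g₀, e₀⟩ := e₀
    obtain ⟨-, f₁, y₁, g₁, e₁⟩ := e₁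
    obtain ⟨-, f₂, y₂, g₂, e₂⟩ := e₂
    obtain ⟨-, f₃, y₃, g₃, e₃⟩ := e₃
    simp only at f₀ f₁ f₂ f₃ g₀ g₁ g₂ g₃
    subst g₀ g₁ g₂ g₃
    rw [f₀, f₁, WithTop.coe_lt_coe] at h₀
    rw [f₁, f₂, WithTop.coe_lt_coe] at h₁
    rw [f₂, f₃, WithTop.coe_lt_coe] at h₂
    -- Different copies of `T` occupy disjoint intervals of columns, so alternating rows belong to
    -- the same copy.
    have hE : (ofLex a).1 = (ofLex b).1 := by
      rcases h₀ with h | h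
      · rcases h₁ with h' | h'
        · exact absurd (h.trans h') (lt_irrefl _)
        · exact h'.1
      · exact h.1.symm
    rw [hE] at h₀ h₁ h₂ hab
    simp only [lt_irrefl, false_or, true_and] at h₀ h₁ h₂ hab
    exact T.avoids _ _ _ _ _ _ hab h₀ h₁ h₂ e₀ e₁ e₂ e₃
  · obtain ⟨-, f₁, y₁, g₁, e₁⟩ := e₁
    obtain ⟨-, f₃, y₃, g₃, e₃⟩ := e₃
    simp only at f₁ f₃ g₁ g₃
    subst g₁ g₃ f₁ f₃
    -- The third column lies between two ones of a row of one copy of `T`, hence inside that copy.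
    -- There the row of `S` has only its new first one, which leaves no room for an earlier one.
    have hp : p₂ = (ofLex a).1 := by
      rcases h₁ with h | h
      · rcases h₂ with h' | h'
        · exact absurd (h.trans h') (lt_irrefl _)
        · exact h'.1
      · exact h.1.symm
    subst hp
    simp only [lt_irrefl, false_or, true_and] at h₁ h₂
    obtain ⟨hb, f₂, g₂⟩ := shuffleE_inr_of_ne e₂ h₂.ne_top
    simp only at f₂ g₂
    have h3 := S.first_le _ _ (shuffleE_inr_fst e₀)
    rw [← f₂] at h3
    simp only at h3
    rcases h₀ with h | ⟨h, h'⟩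
    · exact absurd h h3.not_gt
    · obtain ⟨-, -, g₀⟩ := shuffleE_inr_of_ne e₀ h'.ne_top
      simp only at g₀
      rw [g₀, ← g₂] at h'
      exact absurd (h'.trans h₁) (lt_irrefl _)
  · exact absurd hab Sum.Lex.not_inr_lt_inl
  · rw [Sum.Lex.inr_lt_inr_iff] at hab
    have k₀ := shuffleE_inr_fst e₀
    have k₁ := shuffleE_inr_fst e₁
    have k₂ := shuffleE_inr_fst e₂
    have k₃ := shuffleE_inr_fst e₃
    simp only at k₀ k₁ k₂ k₃
    have l₀ : p₀ ≤ p₁ := h₀.elim le_of_lt fun h => h.1.le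
    have l₁ : p₁ ≤ p₂ := h₁.elim le_of_lt fun h => h.1.le
    have l₂ : p₂ ≤ p₃ := h₂.elim le_of_lt fun h => h.1.le
    -- For rows of different fans of `S`, consecutive columns of the pattern project to distinct
    -- columns of `S`: sharing one would put a row in the fan column of the other. The whole pattern
    -- thus descends to `S`.
    have key : ∀ {r s : S.R} {p p' : S.C} {q q' : WithTop T.C},
        shuffleE S T idx (Sum.inr r) (p, q) → shuffleE S T idx (Sum.inr s) (p', q') →
        (p < p' ∨ p = p' ∧ q < q') → S.first r ≠ S.first s → p < p' := by
      intro r s p p' q q' h h' hlt hne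
      rcases hlt with hlt | ⟨rfl, hlt⟩
      · exact hlt
      · obtain ⟨hr, f, -⟩ := shuffleE_inr_of_ne h hlt.ne_top
        refine absurd ?_ hne
        simp only at f
        rw [← f]
        exact S.eq_first _ _ (shuffleE_inr_fst h') (f ▸ S.first_mem _ hr)
    by_cases hfan : S.first a = S.first b
    · have hbr := S.mem_rows _ _ k₀
      have har := S.mem_rows _ _ k₁
      have hlt := hidx _ (S.first_mem b hbr) ⟨har, hfan⟩ ⟨hbr, rfl⟩ hab
      have m₀ := S.first_le _ _ k₀
      -- The new one of `a` precedes that of `b`, so the first column of `a` in the pattern is not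
      -- that new one. The next one of `b` then lies strictly beyond the old fan column, where
      -- `fan_lt` forbids `a` to return.
      have m₁ : S.first b < p₁ ∨ S.first b = p₁ ∧ q₁ = ⊤ := by
        rcases (m₀.trans l₀).lt_or_eq with h | h
        · exact Or.inl h
        · refine Or.inr ⟨h, ?_⟩
          by_contra hq
          obtain ⟨-, -, g⟩ := shuffleE_inr_of_ne e₁ hq
          have h0 : p₀ = p₁ := le_antisymm l₀ (h ▸ m₀)
          simp only [h0, lt_irrefl, false_or, true_and] at h₀
          obtain ⟨-, -, g'⟩ := shuffleE_inr_of_ne e₀ h₀.ne_top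
          simp only at g g'
          rw [g, g', WithTop.coe_lt_coe] at h₀
          exact absurd (h₀.trans hlt) (lt_irrefl _)
      have m₂ : S.first b < p₂ := by
        rcases m₁ with h | ⟨h, h'⟩
        · exact h.trans_le l₁
        · rw [h]
          rcases h₁ with h₁ | ⟨-, h₁⟩
          · exact h₁
          · rw [h'] at h₁
            exact absurd h₁ not_top_lt
      exact absurd (S.fan_lt _ _ _ _ hab hfan k₃ k₂ (hfan ▸ m₂.trans_le l₂) m₂) l₂.not_gt
    · exact S.avoids _ _ _ _ _ _ hab (key e₀ e₁ h₀ (Ne.symm hfan)) (key e₁ e₂ h₁ hfan)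
        (key e₂ e₃ h₂ (Ne.symm hfan)) k₀ k₁ k₂ k₃

/-- Two rows from copies of `T` inherit the property. A row of a copy finishes inside that copy,
before the remaining ones of any row of `S` that shares its fan column. Two rows of `S` never share
one, by injectivity of `idx`. -/
theorem shuffleE_fan_lt
    (hidx : ∀ φ ∈ S.fans, Set.InjOn idx {r | r ∈ S.rows ∧ S.first r = φ})
    (a b : (S.C ×ₗ T.R) ⊕ S.R) (c d : S.C × WithTop T.C)
    (hab : toLex a < toLex b) (hfan : shuffleFirst S T idx a = shuffleFirst S T idx b)
    (hc : shuffleE S T idx a c) (hd : shuffleE S T idx b d)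
    (hc' : toLex (shuffleFirst S T idx a) < toLex c)
    (hd' : toLex (shuffleFirst S T idx b) < toLex d) : toLex c < toLex d := by
  obtain ⟨p, q⟩ := c
  obtain ⟨p', q'⟩ := d
  rw [Prod.Lex.toLex_lt_toLex] at hc' hd' ⊢
  rcases a with a | a <;> rcases b with b | b
  · rw [Sum.Lex.inl_lt_inl_iff, Prod.Lex.lt_iff] at hab
    obtain ⟨-, f, y, g, hc⟩ := hc
    obtain ⟨-, f', y', g', hd⟩ := hd
    simp only [shuffleFirst, Prod.mk.injEq, WithTop.coe_inj] at f f' g g' hfan hc' hd' ⊢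
    subst g g' f f'
    simp only [lt_irrefl, false_or, true_and, WithTop.coe_lt_coe, hfan.1] at hc' hd' hab ⊢
    exact T.fan_lt _ _ _ _ hab hfan.2 hc hd hc' hd'
  · obtain ⟨-, f, y, g, hc⟩ := hc
    simp only [shuffleFirst, Prod.mk.injEq] at f g hfan hc' hd' ⊢
    subst f g
    have h := S.first_le _ _ (shuffleE_inr_fst hd)
    simp only at h
    rw [← hfan.1] at h
    rcases h.lt_or_eq with h | h
    · exact Or.inl h
    · refine Or.inr ⟨h, ?_⟩
      by_contra hq
      have hq' : q' ≠ ⊤ := fun h => hq (h ▸ WithTop.coe_lt_top y)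
      obtain ⟨-, f', g'⟩ := shuffleE_inr_of_ne hd hq'
      simp only at f' g'
      simp [f', g'] at hd'
  · exact absurd hab Sum.Lex.not_inr_lt_inl
  · rw [Sum.Lex.inr_lt_inr_iff] at hab
    simp only [shuffleFirst, Prod.mk.injEq, WithTop.coe_inj] at hfan
    have ha := S.mem_rows _ _ (shuffleE_inr_fst hc)
    have hb := S.mem_rows _ _ (shuffleE_inr_fst hd)
    exact absurd (hidx _ (S.first_mem b hb) ⟨ha, hfan.1⟩ ⟨hb, rfl⟩ hfan.2) hab.ne

variable (S T) in
/-- The rows of the matrix `shuffleE`. -/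
def shuffleRows : Finset ((S.C ×ₗ T.R) ⊕ S.R) :=
  ((S.fans ×ˢ T.rows).map toLex.toEmbedding).disjSum S.rows

variable (S T) in
/-- The columns of the matrix `shuffleE`. -/
def shuffleCols : Finset (S.C × WithTop T.C) :=
  (S.fans ×ˢ T.cols).map ((Function.Embedding.refl _).prodMap Function.Embedding.coeWithTop) ∪
    S.cols.map ⟨fun c => (c, ⊤), fun _ _ h => (Prod.ext_iff.1 h).1⟩

variable (S T) in
/-- The fan columns of the matrix `shuffleE`. -/
def shuffleFans : Finset (S.C × WithTop T.C) :=
  (S.fans ×ˢ T.fans).map ((Function.Embedding.refl _).prodMap Function.Embedding.coeWithTop)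

theorem inl_mem_shuffleRows {p : S.C ×ₗ T.R} :
    Sum.inl p ∈ shuffleRows S T ↔ (ofLex p).1 ∈ S.fans ∧ (ofLex p).2 ∈ T.rows := by
  rw [shuffleRows, Finset.inl_mem_disjSum, Finset.mem_map_equiv, Finset.mem_product]
  rfl

theorem inr_mem_shuffleRows {r : S.R} : Sum.inr r ∈ shuffleRows S T ↔ r ∈ S.rows := by
  rw [shuffleRows, Finset.inr_mem_disjSum]

theorem mem_shuffleFans {c : S.C × WithTop T.C} :
    c ∈ shuffleFans S T ↔ c.1 ∈ S.fans ∧ ∃ y ∈ T.fans, c.2 = y := by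
  obtain ⟨p, q⟩ := c
  simp only [shuffleFans, Finset.mem_map, Finset.mem_product, Prod.exists,
    Function.Embedding.coe_prodMap, Function.Embedding.refl_apply, Prod.map,
    Function.Embedding.coeWithTop_apply, Prod.mk.injEq]
  constructor
  · rintro ⟨a, b, ⟨h, h'⟩, rfl, rfl⟩
    exact ⟨h, b, h', rfl⟩
  · rintro ⟨h, b, h', rfl⟩
    exact ⟨p, b, ⟨h, h'⟩, rfl, rfl⟩

theorem mem_shuffleCols {c : S.C × WithTop T.C} :
    c ∈ shuffleCols S T ↔ (c.1 ∈ S.fans ∧ ∃ y ∈ T.cols, c.2 = y) ∨ (c.1 ∈ S.cols ∧ c.2 = ⊤) := by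
  obtain ⟨p, q⟩ := c
  simp only [shuffleCols, Finset.mem_union, Finset.mem_map, Finset.mem_product, Prod.exists,
    Function.Embedding.coe_prodMap, Function.Embedding.refl_apply, Prod.map,
    Function.Embedding.coeWithTop_apply, Prod.mk.injEq]
  constructor
  · rintro (⟨a, b, ⟨h, h'⟩, rfl, rfl⟩ | ⟨a, h, h'⟩)
    · exact Or.inl ⟨h, b, h', rfl⟩
    · obtain ⟨rfl, rfl⟩ := Prod.ext_iff.1 h'
      exact Or.inr ⟨h, rfl⟩
  · rintro (⟨h, b, h', rfl⟩ | ⟨h, rfl⟩)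
    · exact Or.inl ⟨p, b, ⟨h, h'⟩, rfl, rfl⟩
    · exact Or.inr ⟨p, h, rfl⟩

theorem card_shuffleCols_le :
    (shuffleCols S T).card ≤ S.fans.card * T.cols.card + S.cols.card := by
  refine (Finset.card_union_le _ _).trans ?_
  simp

/-- Each fan column of a copy keeps its `m` rows and gains exactly one row of `S`, since `idx` is
bijective on each fan. -/
theorem ncard_shuffle_fan
    (hidx : ∀ φ ∈ S.fans, Set.BijOn idx {r | r ∈ S.rows ∧ S.first r = φ} T.fans)
    {c : S.C × WithTop T.C} (hc : c ∈ shuffleFans S T) :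
    Set.ncard {r | r ∈ shuffleRows S T ∧ shuffleFirst S T idx r = c} = m + 1 := by
  obtain ⟨φ, q⟩ := c
  obtain ⟨hφ, y, hy, h⟩ := mem_shuffleFans.1 hc
  simp only at hφ h
  subst h
  obtain ⟨r, ⟨hr, hrφ⟩, hry⟩ := (hidx φ hφ).surjOn hy
  have : {r | r ∈ shuffleRows S T ∧ shuffleFirst S T idx r = (φ, (y : WithTop T.C))} =
      insert (Sum.inr r) ((fun x => Sum.inl (toLex (φ, x))) '' {x | x ∈ T.rows ∧ T.first x = y}) := by
    ext s
    rcases s with p | s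
    · simp only [Set.mem_ofPred_eq, inl_mem_shuffleRows, shuffleFirst, Prod.mk.injEq,
        WithTop.coe_inj, Set.mem_insert_iff, reduceCtorEq, false_or, Set.mem_image, Sum.inl.injEq]
      constructor
      · rintro ⟨⟨-, h⟩, rfl, h'⟩
        exact ⟨_, ⟨h, h'⟩, rfl⟩
      · rintro ⟨x, ⟨h, h'⟩, rfl⟩
        exact ⟨⟨hφ, h⟩, rfl, h'⟩
    · simp only [Set.mem_ofPred_eq, inr_mem_shuffleRows, shuffleFirst, Prod.mk.injEq,
        WithTop.coe_inj, Set.mem_insert_iff, Sum.inr.injEq, Set.mem_image, reduceCtorEq, and_false,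
        exists_false, or_false]
      constructor
      · rintro ⟨h, h', h''⟩
        exact (hidx φ hφ).injOn ⟨h, h'⟩ ⟨hr, hrφ⟩ (h''.trans hry.symm)
      · rintro rfl
        exact ⟨hr, hrφ, hry⟩
  rw [this, Set.ncard_insert_of_notMem (by simp) (Set.Finite.image _
    (T.rows.finite_toSet.subset fun x hx => hx.1)), Set.ncard_image_of_injective, T.card_fan y hy]
  intro x x' h
  simpa using h

theorem ncard_shuffle_row {r : (S.C ×ₗ T.R) ⊕ S.R} (hr : r ∈ shuffleRows S T) :
    Set.ncard {c | shuffleE S T idx r c} = k + 1 := by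
  rcases r with p | r
  · obtain ⟨h, h'⟩ := inl_mem_shuffleRows.1 hr
    have : {c | shuffleE S T idx (Sum.inl p) c} =
        (fun y : T.C => ((ofLex p).1, (y : WithTop T.C))) '' {y | T.E (ofLex p).2 y} := by
      ext ⟨c, q⟩
      constructor
      · rintro ⟨-, rfl, y, rfl, hy⟩
        exact ⟨y, hy, rfl⟩
      · rintro ⟨y, hy, h⟩
        obtain ⟨rfl, rfl⟩ := Prod.mk.inj h
        exact ⟨‹_›, rfl, y, rfl, hy⟩
    rw [this, Set.ncard_image_of_injective, T.card_row _ h']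
    intro y y' h
    simpa using h
  · have h := inr_mem_shuffleRows.1 hr
    have : {c | shuffleE S T idx (Sum.inr r) c} = insert (S.first r, (idx r : WithTop T.C))
        ((fun c => (c, ⊤)) '' {c | S.E r c}) := by
      ext ⟨c, q⟩
      constructor
      · rintro (⟨rfl, hc⟩ | ⟨-, rfl, rfl⟩)
        · exact Or.inr ⟨c, hc, rfl⟩
        · exact Or.inl rfl
      · rintro (h' | ⟨c', hc, h'⟩)
        · obtain ⟨rfl, rfl⟩ := Prod.mk.inj h'
          exact Or.inr ⟨h, rfl, rfl⟩
        · obtain ⟨rfl, rfl⟩ := Prod.mk.inj h'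
          exact Or.inl ⟨rfl, hc⟩
    rw [this, Set.ncard_insert_of_notMem (by simp) ((S.finite_row r).image _),
      Set.ncard_image_of_injective _ (fun _ _ h => (Prod.ext_iff.1 h).1), S.card_row r h]

variable (S T idx) in
/-- The matrix `shuffleE`, with lexicographically ordered rows and columns. -/
def shuffle (hidx : ∀ φ ∈ S.fans, StrictMonoOn idx {r | r ∈ S.rows ∧ S.first r = φ} ∧
    Set.BijOn idx {r | r ∈ S.rows ∧ S.first r = φ} T.fans) :
    FanMatrix (k + 1) (m + 1) (F' * F) where
  R := (S.C ×ₗ T.R) ⊕ₗ S.R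
  C := S.C ×ₗ WithTop T.C
  rows := (shuffleRows S T).map toLex.toEmbedding
  cols := (shuffleCols S T).map toLex.toEmbedding
  fans := (shuffleFans S T).map toLex.toEmbedding
  first := fun r => toLex (shuffleFirst S T idx (ofLex r))
  E := fun r c => shuffleE S T idx (ofLex r) (ofLex c)
  mem_rows := by
    intro r c h
    rw [Finset.mem_map_equiv]
    change (show _ ⊕ _ from r) ∈ _
    rcases r with p | r
    · obtain ⟨h, -, y, -, h'⟩ := h
      exact inl_mem_shuffleRows.2 ⟨h, T.mem_rows _ _ h'⟩
    · exact inr_mem_shuffleRows.2 (S.mem_rows _ _ (shuffleE_inr_fst h))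
  mem_cols := by
    intro r c h
    rw [Finset.mem_map_equiv]
    change ofLex c ∈ _
    rw [mem_shuffleCols]
    rcases r with p | r
    · obtain ⟨h1, h2, y, h3, h⟩ := h
      exact Or.inl ⟨h2 ▸ h1, y, T.mem_cols _ _ h, h3⟩
    · obtain ⟨h1, h⟩ | ⟨hr, h1, h2⟩ := h
      · exact Or.inr ⟨S.mem_cols _ _ h, h1⟩
      · have h3 := S.first_mem r hr
        exact Or.inl ⟨h1 ▸ h3, idx r, T.fans_subset ((hidx _ h3).2.mapsTo ⟨hr, rfl⟩), h2⟩
  fans_subset := by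
    rw [Finset.map_subset_map]
    intro c h
    obtain ⟨h, y, hy, h'⟩ := mem_shuffleFans.1 h
    exact mem_shuffleCols.2 (Or.inl ⟨h, y, T.fans_subset hy, h'⟩)
  card_fans := by
    rw [Finset.card_map, shuffleFans, Finset.card_map, Finset.card_product, S.card_fans,
      T.card_fans]
  first_mem := by
    intro r hr
    rw [Finset.mem_map_equiv] at hr ⊢
    change (show _ ⊕ _ from r) ∈ _ at hr
    change shuffleFirst S T idx (ofLex r) ∈ _
    rcases r with p | r
    · obtain ⟨h, h'⟩ := inl_mem_shuffleRows.1 hr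
      exact mem_shuffleFans.2 ⟨h, _, T.first_mem _ h', rfl⟩
    · have h := inr_mem_shuffleRows.1 hr
      have h3 := S.first_mem r h
      exact mem_shuffleFans.2 ⟨h3, _, (hidx _ h3).2.mapsTo ⟨h, rfl⟩, rfl⟩
  E_first := by
    intro r hr
    rw [Finset.mem_map_equiv] at hr
    change (show _ ⊕ _ from r) ∈ _ at hr
    change shuffleE S T idx (ofLex r) (shuffleFirst S T idx (ofLex r))
    rcases r with p | r
    · obtain ⟨h, h'⟩ := inl_mem_shuffleRows.1 hr
      exact ⟨h, rfl, _, rfl, T.E_first _ h'⟩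
    · exact Or.inr ⟨inr_mem_shuffleRows.1 hr, rfl, rfl⟩
  first_le := fun r c h => shuffleE_first_le h
  eq_first := by
    intro r c h hc
    rw [Finset.mem_map_equiv] at hc
    change ofLex c ∈ _ at hc
    obtain ⟨-, y, hy, h'⟩ := mem_shuffleFans.1 hc
    have h2 : ofLex c = ((ofLex c).1, (y : WithTop T.C)) := Prod.ext rfl h'
    rw [h2] at h
    exact h2.trans (shuffleE_eq_first h hy)
  card_fan := by
    intro c hc
    rw [Finset.mem_map_equiv] at hc
    refine Eq.trans ?_ (ncard_shuffle_fan (fun φ hφ => (hidx φ hφ).2) hc)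
    congr 1
    ext r
    rw [Set.mem_ofPred_eq, Finset.mem_map_equiv]
    rfl
  card_row := by
    intro r hr
    rw [Finset.mem_map_equiv] at hr
    exact ncard_shuffle_row hr
  avoids := fun a b c₀ c₁ c₂ c₃ hab h₀ h₁ h₂ =>
    shuffleE_avoids (fun φ hφ => (hidx φ hφ).1) _ _ (ofLex c₀) (ofLex c₁) (ofLex c₂) (ofLex c₃)
      hab h₀ h₁ h₂
  fan_lt := fun a b c d hab h hc hd h' h'' =>
    shuffleE_fan_lt (fun φ hφ => (hidx φ hφ).2.injOn) _ _ (ofLex c) (ofLex d) hab h hc hd h' h''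

end Shuffle

/-- The fan size of `S` equals the number of fan columns of `T`, so an increasing bijection can be
chosen separately for each fan of `S`. -/
theorem exists_shuffle {F' : ℕ} (hF : 0 < F) (S : FanMatrix k F F') (T : FanMatrix (k + 1) m F) :
    ∃ U : FanMatrix (k + 1) (m + 1) (F' * F),
      U.cols.card ≤ F' * T.cols.card + S.cols.card := by
  classical
  obtain ⟨y, -⟩ : T.fans.Nonempty := Finset.card_pos.1 (T.card_fans.symm ▸ hF)
  have : Nonempty T.C := ⟨y⟩
  have h1 : ∀ φ : S.C, ∃ f : S.R → T.C, φ ∈ S.fans →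
      StrictMonoOn f {r | r ∈ S.rows ∧ S.first r = φ} ∧
      Set.BijOn f {r | r ∈ S.rows ∧ S.first r = φ} T.fans := by
    intro φ
    by_cases hφ : φ ∈ S.fans
    · obtain ⟨f, hf⟩ := exists_strictMonoOn_bijOn (S.rows.filter fun r => S.first r = φ) T.fans (by
        rw [T.card_fans, ← Set.ncard_coe_finset, Finset.coe_filter]
        exact S.card_fan φ hφ)
      rw [Finset.coe_filter] at hf
      exact ⟨f, fun _ => hf⟩
    · exact ⟨fun _ => y, fun h => absurd h hφ⟩
  choose f hf using h1
  refine ⟨shuffle S T (fun r => f (S.first r) r) fun φ hφ => ?_, ?_⟩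
  · have heq : Set.EqOn (f φ) (fun r => f (S.first r) r) {r | r ∈ S.rows ∧ S.first r = φ} := by
      rintro r ⟨-, rfl⟩
      rfl
    exact ⟨(hf φ hφ).1.congr heq, (hf φ hφ).2.congr heq⟩
  · refine (Finset.card_map _).trans_le ?_
    have h := card_shuffleCols_le (S := S) (T := T)
    rwa [S.card_fans] at h

/-- The invariant says that there are at most `(2 - 2⁻ᵐ) F` columns. With `f` the number of fan
columns of `T`, a shuffle increases the ratio of columns to fan columns by at most `2 / f`, and `f ≥
4 * 2 ^ m` makes this at most `2⁻⁽ᵐ⁺¹⁾`. -/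
theorem exists_fanMatrix (k m : ℕ) : ∃ T : FanMatrix (k + 1) m (fanCount k m),
    T.cols.card * 2 ^ m + fanCount k m ≤ 2 ^ (m + 1) * fanCount k m := by
  induction k generalizing m with
  | zero =>
    rw [fanCount]
    refine ⟨single m 2, ?_⟩
    have h : (single m 2).cols.card = 2 := Finset.card_fin 2
    have := Nat.one_le_two_pow (n := m)
    rw [h, pow_succ]
    omega
  | succ k ih =>
    induction m with
    | zero =>
      rw [fanCount]
      refine ⟨empty (k + 2) 4, ?_⟩
      have h : (empty (k + 2) 4).cols.card = 4 := Finset.card_fin 4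
      rw [h]
      norm_num
    | succ m ihm =>
      obtain ⟨T, hT⟩ := ihm
      obtain ⟨S, hS⟩ := ih (fanCount (k + 1) m)
      obtain ⟨U, hU⟩ := exists_shuffle (by have := two_le_fanCount (k + 1) m; omega) S T
      rw [fanCount, mul_comm (fanCount (k + 1) m)]
      refine ⟨U, ?_⟩
      have hf := two_pow_le_fanCount k m
      generalize fanCount (k + 1) m = f at *
      generalize fanCount k f = g at *
      have hS' : S.cols.card ≤ 2 * g := by
        refine Nat.le_of_mul_le_mul_right (c := 2 ^ f) ?_ (by positivity)
        rw [pow_succ] at hS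
        linarith
      rw [pow_succ] at hT
      rw [pow_succ, pow_succ, pow_succ]
      generalize 2 ^ m = p at *
      calc U.cols.card * (p * 2) + g * f
          ≤ (g * T.cols.card + 2 * g) * (p * 2) + g * f := by gcongr; exact hU.trans (by gcongr)
        -- Adding and subtracting `g * f` exposes the left side of the invariant of `T`.
        _ = 2 * g * (T.cols.card * p + f) + g * (4 * p) - g * f := by
          apply Nat.eq_sub_of_add_eq
          ring
        _ ≤ 2 * g * (p * 2 * f) + g * f - g * f := by gcongr
        _ = p * 2 * 2 * (g * f) := by
          rw [Nat.add_sub_cancel]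
          ring

end FanMatrix

/-! ### Square matrices with rows of prescribed weight -/

theorem exists_avoiding_matrix (k : ℕ) :
    ∃ M : Matrix (Fin (4 * fanCount k 4)) (Fin (4 * fanCount k 4)) Bool,
      ¬ MatrixContains M alternatingPattern ∧ ∀ i, rowWeight M i = k + 1 := by
  classical
  obtain ⟨T, hT⟩ := FanMatrix.exists_fanMatrix k 4
  -- Fans of size 4 give four rows per fan column against fewer than two columns; empty columns on
  -- the right make the matrix square.
  have hcols : T.cols.card ≤ 4 * fanCount k 4 := by omega
  let e := T.rows.orderIsoOfFin (T.card_rows.trans (mul_comm _ _))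
  let f := T.cols.orderIsoOfFin rfl
  let M : Matrix (Fin (4 * fanCount k 4)) (Fin (4 * fanCount k 4)) Bool := fun i j =>
    decide (∃ h : j.1 < T.cols.card, T.E (e i) (f ⟨j, h⟩))
  have hM : ∀ i j, M i j = true ↔ ∃ h : j.1 < T.cols.card, T.E (e i) (f ⟨j, h⟩) := fun i j =>
    decide_eq_true_iff
  refine ⟨M, ?_, fun i => ?_⟩
  · rintro ⟨r, c, h⟩
    obtain ⟨l₀, h₀⟩ := (hM _ _).1 (h 1 0 rfl)
    obtain ⟨l₁, h₁⟩ := (hM _ _).1 (h 0 1 rfl)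
    obtain ⟨l₂, h₂⟩ := (hM _ _).1 (h 1 2 rfl)
    obtain ⟨l₃, h₃⟩ := (hM _ _).1 (h 0 3 rfl)
    refine T.avoids _ _ _ _ _ _ ?_ ?_ ?_ ?_ h₀ h₁ h₂ h₃
    · exact e.strictMono (r.strictMono (by decide))
    · exact f.strictMono (c.strictMono (by decide : (0 : Fin 4) < 1))
    · exact f.strictMono (c.strictMono (by decide : (1 : Fin 4) < 2))
    · exact f.strictMono (c.strictMono (by decide : (2 : Fin 4) < 3))
  · rw [← T.card_row (e i) (e i).2, rowWeight, ← Set.ncard_coe_finset]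
    refine Set.ncard_congr (fun j hj => f ⟨j, ((hM i j).1 (by simpa using hj)).1⟩) ?_ ?_ ?_
    · intro j hj
      exact ((hM i j).1 (by simpa using hj)).2
    · intro j j' hj hj' h
      simpa [Subtype.ext_iff, Fin.ext_iff] using h
    · intro c hc
      have hc' := T.mem_cols _ _ hc
      have hlt := (f.symm ⟨c, hc'⟩).2
      have heq : f ⟨(f.symm ⟨c, hc'⟩).1, hlt⟩ = ⟨c, hc'⟩ := f.apply_symm_apply _
      refine ⟨⟨(f.symm ⟨c, hc'⟩).1, hlt.trans_le hcols⟩, ?_, ?_⟩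
      · simp only [Finset.coe_filter, Finset.mem_univ, true_and, Set.mem_ofPred_eq]
        refine (hM _ _).2 ⟨hlt, ?_⟩
        rw [heq]
        exact hc
      · simp only [heq]

theorem exists_avoiding_matrix_rowWeight_eq (k w : ℕ) (hw : w ≤ k + 1) :
    ∃ M : Matrix (Fin (4 * fanCount k 4)) (Fin (4 * fanCount k 4)) Bool,
      ¬ MatrixContains M alternatingPattern ∧ ∀ i, rowWeight M i = w := by
  classical
  obtain ⟨M, hM, hrow⟩ := exists_avoiding_matrix k
  have h : ∀ i, ∃ t ⊆ Finset.univ.filter fun j => M i j = true, t.card = w := fun i =>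
    Finset.exists_subset_card_eq (hw.trans_eq (hrow i).symm)
  choose t ht hcard using h
  refine ⟨fun i j => decide (j ∈ t i), ?_, fun i => ?_⟩
  · rintro ⟨r, c, h⟩
    refine hM ⟨r, c, fun i j hij => ?_⟩
    simpa using ht _ (of_decide_eq_true (h i j hij))
  · simpa [rowWeight] using hcard i

theorem matrixWeight_eq_sum {m n : ℕ} (M : Matrix (Fin m) (Fin n) Bool) :
    matrixWeight M = ∑ i, rowWeight M i := by
  simp_rw [matrixWeight, rowWeight, Finset.card_filter]
  rw [Fintype.sum_prod_type]

/-- A row with `k + 1` ones needs at least that many columns. -/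
theorem le_mul_fanCount (k : ℕ) : k + 1 ≤ 4 * fanCount k 4 := by
  obtain ⟨M, -, h⟩ := exists_avoiding_matrix k
  have := two_le_fanCount k 4
  rw [← h ⟨0, by omega⟩, rowWeight]
  exact (Finset.card_le_univ _).trans_eq (Fintype.card_fin _)

/-! ### Faces of convex hulls of finite sets -/

section Exposed

variable {V : Type*} [NormedAddCommGroup V] [NormedSpace ℝ V]

theorem le_of_mem_convexHull {S : Set V} (l : V →L[ℝ] ℝ) {c : ℝ} (h : ∀ x ∈ S, l x ≤ c) {x : V}
    (hx : x ∈ convexHull ℝ S) : l x ≤ c :=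
  convexHull_min (t := {x | l x ≤ c}) h (convex_halfSpace_le l.toLinearMap.isLinear c) hx

/-- Split a convex combination into a part from the tight points and a part from the others. The
second part has value strictly below `c`, so equality forces its weight to be zero. -/
theorem convexHull_inter_eq {S : Set V} (l : V →L[ℝ] ℝ) {c : ℝ} (h : ∀ x ∈ S, l x ≤ c) :
    convexHull ℝ S ∩ {x | l x = c} = convexHull ℝ (S ∩ {x | l x = c}) := by
  apply Set.Subset.antisymm
  · rintro x ⟨hx, hxc⟩
    have hlt : ∀ y ∈ convexHull ℝ (S \ {x | l x = c}), l y < c := fun y hy =>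
      convexHull_min (t := {x | l x < c}) (fun z hz => (h z hz.1).lt_of_ne hz.2)
        (convex_halfSpace_lt l.toLinearMap.isLinear c) hy
    rw [← Set.inter_union_sdiff S {x | l x = c}] at hx
    rcases (S ∩ {x | l x = c}).eq_empty_or_nonempty with h1 | h1
    · rw [h1, Set.empty_union] at hx
      exact absurd hxc (hlt x hx).ne
    rcases (S \ {x | l x = c}).eq_empty_or_nonempty with h2 | h2
    · rwa [h2, Set.union_empty] at hx
    rw [convexHull_union h1 h2, mem_convexJoin] at hx
    obtain ⟨y, hy, z, hz, a, b, ha, hb, hab, rfl⟩ := hx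
    have hyc : l y ≤ c := le_of_mem_convexHull l (fun x hx => h x hx.1) hy
    rcases hb.eq_or_lt with rfl | hb
    · obtain rfl : a = 1 := by linarith
      simpa using hy
    · have hxc' : a * l y + b * l z = c := by simpa using hxc
      have := mul_lt_mul_of_pos_left (hlt z hz) hb
      have := mul_le_mul_of_nonneg_left hyc ha
      have : (a + b) * c = c := by rw [hab, one_mul]
      linarith
  · refine Set.subset_inter (convexHull_mono Set.inter_subset_left) ?_
    exact convexHull_min Set.inter_subset_right (convex_hyperplane l.toLinearMap.isLinear c)

theorem isExposed_inter_of_le {P : Set V} (l : V →L[ℝ] ℝ) {c : ℝ} (h : ∀ x ∈ P, l x ≤ c) :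
    IsExposed ℝ P (P ∩ {x | l x = c}) := by
  rintro ⟨z, hz, hzc⟩
  refine ⟨l, Set.ext fun x => ⟨?_, ?_⟩⟩
  · rintro ⟨hx, hxc⟩
    exact ⟨hx, fun y hy => (h y hy).trans_eq hxc.symm⟩
  · rintro ⟨hx, hxc⟩
    exact ⟨hx, le_antisymm (h x hx) (hzc.symm.le.trans (hxc z hz))⟩

theorem isExposed_convexHull_inter {S : Set V} (l : V →L[ℝ] ℝ) {c : ℝ} (h : ∀ x ∈ S, l x ≤ c) :
    IsExposed ℝ (convexHull ℝ S) (convexHull ℝ (S ∩ {x | l x = c})) := by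
  rw [← convexHull_inter_eq l h]
  exact isExposed_inter_of_le l fun x hx => le_of_mem_convexHull l h hx

theorem IsExposed.exists_functional {P F : Set V} (h : IsExposed ℝ P F) (hF : F.Nonempty) :
    ∃ (l : V →L[ℝ] ℝ) (c : ℝ), (∀ x ∈ P, l x ≤ c) ∧ F = P ∩ {x | l x = c} := by
  obtain ⟨l, hl⟩ := h hF
  obtain ⟨z, hz⟩ := hF
  have hz' := hl ▸ hz
  refine ⟨l, l z, fun x hx => hz'.2 x hx, ?_⟩
  rw [hl]
  ext x
  constructor
  · rintro ⟨hx, hx'⟩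
    exact ⟨hx, le_antisymm (hz'.2 x hx) (hx' z hz'.1)⟩
  · rintro ⟨hx, hx'⟩
    exact ⟨hx, fun y hy => (hz'.2 y hy).trans_eq (Eq.symm hx')⟩

theorem IsExposed.eq_convexHull {S F : Set V} (h : IsExposed ℝ (convexHull ℝ S) F) :
    F = convexHull ℝ (S ∩ F) := by
  rcases F.eq_empty_or_nonempty with rfl | hF
  · simp
  obtain ⟨l, c, hl, hF⟩ := h.exists_functional hF
  conv_lhs => rw [hF, convexHull_inter_eq l fun x hx => hl x (subset_convexHull ℝ S hx)]
  rw [hF, ← Set.inter_assoc, Set.inter_eq_left.2 (subset_convexHull ℝ S)]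

/-- If `l` exposes `F` and `m` exposes `G` in `F`, then `l + ε m` exposes `G` for small `ε > 0`.
Finiteness of `S` provides one `ε` for all generators off `F`. -/
theorem IsExposed.trans_convexHull {S F G : Set V} (hS : S.Finite)
    (h : IsExposed ℝ (convexHull ℝ S) F) (h' : IsExposed ℝ F G) :
    IsExposed ℝ (convexHull ℝ S) G := by
  rcases G.eq_empty_or_nonempty with rfl | hG
  · exact isExposed_empty
  obtain ⟨l, c, hl, hF⟩ := h.exists_functional (hG.mono h'.subset)
  obtain ⟨m, d, hm, hG⟩ := h'.exists_functional hG
  have hlS : ∀ x ∈ S, l x ≤ c := fun x hx => hl x (subset_convexHull ℝ S hx)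
  rw [convexHull_inter_eq l hlS] at hF
  have hmS : ∀ x ∈ S, l x = c → m x ≤ d := fun x hx hxc =>
    hm x (hF ▸ subset_convexHull ℝ _ ⟨hx, hxc⟩)
  have hev : ∀ᶠ ε : ℝ in nhdsWithin 0 (Set.Ioi 0),
      ∀ x ∈ S, l x < c → l x + ε * m x < c + ε * d := by
    rw [Filter.eventually_all_finite hS]
    intro x _
    by_cases hx : l x < c
    · have h1 : Filter.Tendsto (fun ε : ℝ => l x + ε * m x) (nhds 0) (nhds (l x + 0 * m x)) :=
        (by fun_prop : Continuous fun ε : ℝ => l x + ε * m x).tendsto 0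
      have h2 : Filter.Tendsto (fun ε : ℝ => c + ε * d) (nhds 0) (nhds (c + 0 * d)) :=
        (by fun_prop : Continuous fun ε : ℝ => c + ε * d).tendsto 0
      filter_upwards [nhdsWithin_le_nhds (h1.eventually_lt h2 (by simpa using hx))] with ε hε _
      exact hε
    · exact Filter.Eventually.of_forall fun ε h => absurd h hx
  obtain ⟨ε, hε, hε0⟩ := (hev.and self_mem_nhdsWithin).exists
  replace hε0 : 0 < ε := hε0
  have hle : ∀ x ∈ S, (l + ε • m) x ≤ c + ε * d := by
    intro x hx
    simp only [add_apply, smul_apply, smul_eq_mul]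
    rcases (hlS x hx).lt_or_eq with h | h
    · exact (hε x hx h).le
    · rw [h]
      have := mul_le_mul_of_nonneg_left (hmS x hx h) hε0.le
      linarith
  have hGeq : G = convexHull ℝ (S ∩ {x | (l + ε • m) x = c + ε * d}) := by
    rw [hG, hF, convexHull_inter_eq m fun x hx => hmS x hx.1 hx.2]
    congr 1
    ext x
    simp only [Set.mem_inter_iff, Set.mem_ofPred_eq, add_apply,
      smul_apply, smul_eq_mul]
    constructor
    · rintro ⟨⟨hx, h1⟩, h2⟩
      exact ⟨hx, by rw [h1, h2]⟩
    · rintro ⟨hx, h1⟩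
      rcases (hlS x hx).lt_or_eq with h | h
      · exact absurd h1 (hε x hx h).ne
      · rw [h, add_right_inj] at h1
        exact ⟨⟨hx, h⟩, mul_left_cancel₀ hε0.ne' h1⟩
  rw [hGeq]
  exact isExposed_convexHull_inter _ hle

/-- Faces of two polytopes that meet in a common face meet in a common face. -/
theorem IsExposed.inter_of_inter {S S' F F' : Set V} (hS : S.Finite)
    (h : IsExposed ℝ (convexHull ℝ S) (convexHull ℝ S ∩ convexHull ℝ S'))
    (h' : IsExposed ℝ (convexHull ℝ S') (convexHull ℝ S ∩ convexHull ℝ S'))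
    (hF : IsExposed ℝ (convexHull ℝ S) F) (hF' : IsExposed ℝ (convexHull ℝ S') F') :
    IsExposed ℝ F (F ∩ F') := by
  set G := convexHull ℝ S ∩ convexHull ℝ S' with hG
  have h1 : IsExposed ℝ G (F ∩ G) := (hF.inter h).mono Set.inter_subset_left Set.inter_subset_right
  have h2 : IsExposed ℝ G (F' ∩ G) :=
    (hF'.inter h').mono Set.inter_subset_right Set.inter_subset_right
  have heq : F ∩ F' = (F ∩ G) ∩ (F' ∩ G) := by
    ext x
    constructor
    · rintro ⟨hx, hx'⟩
      have : x ∈ G := ⟨hF.subset hx, hF'.subset hx'⟩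
      exact ⟨⟨hx, this⟩, hx', this⟩
    · rintro ⟨⟨hx, -⟩, hx', -⟩
      exact ⟨hx, hx'⟩
  rw [heq]
  exact (h.trans_convexHull hS (h1.inter h2)).mono hF.subset
    (Set.inter_subset_left.trans Set.inter_subset_left)

end Exposed

/-! ### Separating non-alternating sets by a cubic -/

section Separation

/-- The next sign change: the first element of `X` from `s` on is at `t - 1`, and `r` separates it
from the earlier elements of `Y`. -/
theorem exists_sign_change (X Y : Set ℕ) {s N : ℕ} (hs : s ≤ N) (hY : ∀ y ∈ Y, y < N)
    (hX : ∀ x ∈ X, x < N) :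
    ∃ (r : ℝ) (t : ℕ), s ≤ t ∧ t ≤ N ∧ s - 1 / 2 ≤ r ∧ r ≤ t - 1 / 2 ∧
      (∀ x ∈ X, s ≤ x → r ≤ x ∧ (x = r → x ∈ Y)) ∧
      (∀ y ∈ Y, s ≤ y → y < t → (y : ℝ) ≤ r ∧ (y = r → y ∈ X)) ∧
      (∀ y ∈ Y, t ≤ y → ∃ x ∈ X, s ≤ x ∧ x < t) := by
  classical
  by_cases h : ∃ x, x ∈ X ∧ s ≤ x
  · obtain ⟨hx, hsx⟩ := Nat.find_spec h
    have hmin : ∀ x ∈ X, s ≤ x → Nat.find h ≤ x := fun x h1 h2 => Nat.find_min' h ⟨h1, h2⟩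
    generalize Nat.find h = x₀ at *
    have hsx' : (s : ℝ) ≤ x₀ := by exact_mod_cast hsx
    -- A common element becomes the root itself; otherwise the root is the half-integer just before
    -- `x₀`. The next search starts at `x₀ + 1` in both cases, so the roots found are increasing.
    by_cases hxY : x₀ ∈ Y
    · refine ⟨x₀, x₀ + 1, by omega, hX _ hx, by linarith, by push_cast; linarith, ?_, ?_, ?_⟩
      · intro x h1 h2
        exact ⟨by exact_mod_cast hmin x h1 h2, fun h => by rwa [Nat.cast_inj.1 h]⟩
      · intro y h1 h2 h3
        exact ⟨by exact_mod_cast Nat.lt_succ_iff.1 h3, fun h => by rwa [Nat.cast_inj.1 h]⟩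
      · exact fun _ _ _ => ⟨x₀, hx, hsx, by omega⟩
    · refine ⟨x₀ - 1 / 2, x₀ + 1, by omega, hX _ hx, by linarith, by push_cast; linarith,
        ?_, ?_, ?_⟩
      · intro x h1 h2
        have : (x₀ : ℝ) ≤ x := by exact_mod_cast hmin x h1 h2
        exact ⟨by linarith, fun h => by linarith⟩
      · intro y h1 h2 h3
        have hne : y ≠ x₀ := fun h => hxY (h ▸ h1)
        have : (y : ℝ) + 1 ≤ x₀ := by exact_mod_cast (show y + 1 ≤ x₀ by omega)
        exact ⟨by linarith, fun h => by linarith⟩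
      · exact fun _ _ _ => ⟨x₀, hx, hsx, by omega⟩
  · push Not at h
    have hs' : (s : ℝ) ≤ N := by exact_mod_cast hs
    refine ⟨N - 1 / 2, N, hs, le_rfl, by linarith, le_rfl, ?_, ?_, ?_⟩
    · exact fun x h1 h2 => absurd h2 (h x h1).not_ge
    · intro y h1 h2 h3
      have : (y : ℝ) + 1 ≤ N := by exact_mod_cast h3
      exact ⟨by linarith, fun h => by linarith⟩
    · exact fun y h1 h2 => absurd (hY y h1) h2.not_gt

/-- If two finite sets do not alternate four times, then a cubic polynomial separates them. -/
theorem exists_cubic_separation (A B : Set ℕ) {N : ℕ} (hA : ∀ a ∈ A, a < N) (hB : ∀ b ∈ B, b < N)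
    (h : ∀ b₀ ∈ B, ∀ a₁ ∈ A, ∀ b₂ ∈ B, ∀ a₃ ∈ A, b₀ < a₁ → a₁ < b₂ → ¬ b₂ < a₃) :
    ∃ r₁ r₂ r₃ : ℝ,
      (∀ a ∈ A, (a - r₁) * (a - r₂) * (a - r₃) ≤ 0 ∧
        ((a - r₁) * (a - r₂) * (a - r₃) = 0 → a ∈ B)) ∧
      (∀ b ∈ B, 0 ≤ (b - r₁) * (b - r₂) * (b - r₃) ∧
        ((b - r₁) * (b - r₂) * (b - r₃) = 0 → b ∈ A)) := by
  -- The roots mark, greedily, the first element of `B`, the next element of `A` and the next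
  -- element of `B`. The cubic is negative, positive, negative, positive on the successive
  -- intervals.
  obtain ⟨r₁, t₁, -, ht₁, -, hr₁, hB₁, hA₁, hex₁⟩ := exists_sign_change B A (Nat.zero_le N) hA hB
  obtain ⟨r₂, t₂, ht₁₂, ht₂, hr₂, hr₂', hA₂, hB₂, hex₂⟩ := exists_sign_change A B ht₁ hB hA
  obtain ⟨r₃, t₃, ht₂₃, ht₃, hr₃, hr₃', hB₃, hA₃, hex₃⟩ := exists_sign_change B A ht₂ hA hB
  have ht₁₂' : (t₁ : ℝ) ≤ t₂ := by exact_mod_cast ht₁₂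
  have hlt : ∀ {x t : ℕ}, x < t → (x : ℝ) + 1 ≤ t := fun h => by exact_mod_cast h
  refine ⟨r₁, r₂, r₃, fun a ha => ?_, fun b hb => ?_⟩
  · rcases lt_or_ge a t₁ with h1 | h1
    · obtain ⟨h2, h3⟩ := hA₁ a ha (Nat.zero_le _) h1
      have := hlt h1
      have h4 : (a : ℝ) - r₂ < 0 := by linarith
      have h5 : (a : ℝ) - r₃ < 0 := by linarith
      refine ⟨?_, fun h => h3 ?_⟩
      · rw [mul_assoc]
        exact mul_nonpos_of_nonpos_of_nonneg (by linarith) (mul_pos_of_neg_of_neg h4 h5).le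
      · simpa [h4.ne, h5.ne, sub_eq_zero] using h
    · obtain ⟨h2, h3⟩ := hA₂ a ha h1
      have : (t₁ : ℝ) ≤ a := by exact_mod_cast h1
      have h4 : 0 < (a : ℝ) - r₁ := by linarith
      have h6 : (a : ℝ) ≤ r₃ ∧ (a = r₃ → a ∈ B) := by
        rcases lt_or_ge a t₂ with h5 | h5
        · have := hlt h5
          exact ⟨by linarith, fun h => by linarith⟩
        · refine hA₃ a ha h5 ?_
          -- An element of `A` beyond the third change would complete the alternation `b < a < b <
          -- a`.
          by_contra! h6
          obtain ⟨x₃, hx₃, h7, h8⟩ := hex₃ a ha h6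
          obtain ⟨x₂, hx₂, h9, h10⟩ := hex₂ x₃ hx₃ h7
          obtain ⟨x₁, hx₁, h11, h12⟩ := hex₁ x₂ hx₂ h9
          exact h x₁ hx₁ x₂ hx₂ x₃ hx₃ a ha (by omega) (by omega) (by omega)
      refine ⟨?_, fun h => ?_⟩
      · exact mul_nonpos_of_nonneg_of_nonpos (mul_nonneg h4.le (by linarith)) (by linarith [h6.1])
      · rw [mul_eq_zero, mul_eq_zero, sub_eq_zero, sub_eq_zero (b := r₂), sub_eq_zero (b := r₃)] at h
        rcases h with (h | h) | h
        · linarith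
        · exact h3 h
        · exact h6.2 h
  · obtain ⟨h2, h3⟩ := hB₁ b hb (Nat.zero_le _)
    rcases lt_or_ge b t₂ with h1 | h1
    · have := hlt h1
      have h5 : (b : ℝ) - r₃ < 0 := by linarith
      have h6 : (b : ℝ) ≤ r₂ ∧ (b = r₂ → b ∈ A) := by
        rcases lt_or_ge b t₁ with h7 | h7
        · have := hlt h7
          exact ⟨by linarith, fun h => by linarith⟩
        · exact hB₂ b hb h7 h1
      refine ⟨?_, fun h => ?_⟩
      · exact mul_nonneg_of_nonpos_of_nonpos
          (mul_nonpos_of_nonneg_of_nonpos (by linarith) (by linarith [h6.1])) h5.le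
      · rw [mul_eq_zero, mul_eq_zero, sub_eq_zero, sub_eq_zero (b := r₂)] at h
        rcases h with (h | h) | h
        · exact h3 h
        · exact h6.2 h
        · linarith
    · obtain ⟨h4, h5⟩ := hB₃ b hb h1
      have : (t₂ : ℝ) ≤ b := by exact_mod_cast h1
      have h6 : 0 < (b : ℝ) - r₁ := by linarith
      have h7 : 0 < (b : ℝ) - r₂ := by linarith
      refine ⟨mul_nonneg (mul_pos h6 h7).le (by linarith), fun h => h5 ?_⟩
      simpa [h6.ne', h7.ne', sub_eq_zero] using h

end Separation

/-! ### Polytopes on the moment curve -/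

section MomentCurve

/-- The point of the moment curve in `ℝ³` that belongs to the column with index `j`. -/
noncomputable def curvePoint (j : ℕ) : EuclideanSpace ℝ (Fin 3) := momentCurve 3 ((j : ℝ) + 1)

/-- The linear functional with the given coefficients. -/
noncomputable def coeffFunctional (a b c : ℝ) : EuclideanSpace ℝ (Fin 3) →L[ℝ] ℝ :=
  a • EuclideanSpace.proj 0 + b • EuclideanSpace.proj 1 + c • EuclideanSpace.proj 2

theorem coeffFunctional_apply (a b c : ℝ) (x : EuclideanSpace ℝ (Fin 3)) :
    coeffFunctional a b c x = a * x 0 + b * x 1 + c * x 2 := by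
  simp [coeffFunctional]

theorem curvePoint_apply (j : ℕ) (i : Fin 3) : curvePoint j i = ((j : ℝ) + 1) ^ ((i : ℕ) + 1) := rfl

theorem coeffFunctional_curvePoint (a b c : ℝ) (j : ℕ) :
    coeffFunctional a b c (curvePoint j) =
      a * (j + 1) + b * ((j : ℝ) + 1) ^ 2 + c * ((j : ℝ) + 1) ^ 3 := by
  simp [coeffFunctional_apply, curvePoint_apply]

theorem curvePoint_injective : Function.Injective curvePoint := by
  intro j j' h
  have := congrArg (fun x : EuclideanSpace ℝ (Fin 3) => x 0) h
  simpa [curvePoint_apply] using this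

theorem isExposed_curvePolytope_inter {A B : Set ℕ} {N : ℕ} (hA : ∀ a ∈ A, a < N)
    (hB : ∀ b ∈ B, b < N)
    (h : ∀ b₀ ∈ B, ∀ a₁ ∈ A, ∀ b₂ ∈ B, ∀ a₃ ∈ A, b₀ < a₁ → a₁ < b₂ → ¬ b₂ < a₃) :
    IsExposed ℝ (convexHull ℝ (curvePoint '' A))
        (convexHull ℝ (curvePoint '' A) ∩ convexHull ℝ (curvePoint '' B)) ∧
      IsExposed ℝ (convexHull ℝ (curvePoint '' B))
        (convexHull ℝ (curvePoint '' A) ∩ convexHull ℝ (curvePoint '' B)) := by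
  obtain ⟨r₁, r₂, r₃, hA', hB'⟩ := exists_cubic_separation A B hA hB h
  obtain ⟨l, c, hl⟩ : ∃ (l : EuclideanSpace ℝ (Fin 3) →L[ℝ] ℝ) (c : ℝ), ∀ j : ℕ,
      l (curvePoint j) = (j - r₁) * (j - r₂) * (j - r₃) + c := by
    -- Expanded coefficients of the cubic in the curve parameter `j + 1`, whose roots are `rᵢ + 1`;
    -- its constant term goes into `c`.
    refine ⟨coeffFunctional ((r₁ + 1) * (r₂ + 1) + (r₁ + 1) * (r₃ + 1) + (r₂ + 1) * (r₃ + 1))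
      (-(r₁ + r₂ + r₃ + 3)) 1, (r₁ + 1) * (r₂ + 1) * (r₃ + 1), fun j => ?_⟩
    rw [coeffFunctional_curvePoint]
    ring
  have hlA : ∀ x ∈ curvePoint '' A, l x ≤ c := by
    rintro _ ⟨j, hj, rfl⟩
    rw [hl]
    linarith [(hA' j hj).1]
  have hlB : ∀ x ∈ curvePoint '' B, (-l) x ≤ -c := by
    rintro _ ⟨j, hj, rfl⟩
    rw [neg_apply, hl]
    linarith [(hB' j hj).1]
  have hneg : {x | (-l) x = -c} = {x | l x = c} := by
    ext x
    simp
  have hzA : curvePoint '' A ∩ {x | l x = c} = curvePoint '' (A ∩ B) := by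
    ext x
    constructor
    · rintro ⟨⟨j, hj, rfl⟩, hx⟩
      refine ⟨j, ⟨hj, (hA' j hj).2 ?_⟩, rfl⟩
      rw [Set.mem_ofPred_eq, hl] at hx
      linarith
    · rintro ⟨j, ⟨hj, hj'⟩, rfl⟩
      refine ⟨⟨j, hj, rfl⟩, ?_⟩
      rw [Set.mem_ofPred_eq, hl]
      linarith [(hA' j hj).1, (hB' j hj').1]
  have hzB : curvePoint '' B ∩ {x | l x = c} = curvePoint '' (A ∩ B) := by
    ext x
    constructor
    · rintro ⟨⟨j, hj, rfl⟩, hx⟩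
      refine ⟨j, ⟨(hB' j hj).2 ?_, hj⟩, rfl⟩
      rw [Set.mem_ofPred_eq, hl] at hx
      linarith
    · rintro ⟨j, ⟨hj, hj'⟩, rfl⟩
      refine ⟨⟨j, hj', rfl⟩, ?_⟩
      rw [Set.mem_ofPred_eq, hl]
      linarith [(hA' j hj).1, (hB' j hj').1]
  have heq : convexHull ℝ (curvePoint '' A) ∩ convexHull ℝ (curvePoint '' B) =
      convexHull ℝ (curvePoint '' (A ∩ B)) := by
    apply Set.Subset.antisymm
    · rintro x ⟨hx, hx'⟩
      rw [← hzA, ← convexHull_inter_eq l hlA]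
      refine ⟨hx, le_antisymm (le_of_mem_convexHull l hlA hx) ?_⟩
      have := le_of_mem_convexHull (-l) hlB hx'
      rw [neg_apply] at this
      linarith
    · exact Set.subset_inter (convexHull_mono (Set.image_mono Set.inter_subset_left))
        (convexHull_mono (Set.image_mono Set.inter_subset_right))
  rw [heq]
  refine ⟨?_, ?_⟩
  · rw [← hzA]
    exact isExposed_convexHull_inter l hlA
  · rw [← hzB, ← hneg]
    exact isExposed_convexHull_inter (-l) hlB

/-- A functional whose maximum over the points of the moment curve is attained at one point. -/
theorem exists_functional_lt (j : ℕ) : ∃ (l : EuclideanSpace ℝ (Fin 3) →L[ℝ] ℝ) (c : ℝ),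
    ∀ i : ℕ, l (curvePoint i) ≤ c ∧ (l (curvePoint i) = c ↔ i = j) := by
  -- The functional is chosen so that its value at column `i` is `(j + 1)² - (i - j)²`.
  refine ⟨coeffFunctional (2 * (j + 1)) (-1) 0, ((j : ℝ) + 1) ^ 2, fun i => ?_⟩
  rw [coeffFunctional_curvePoint]
  have h : 2 * ((j : ℝ) + 1) * (i + 1) + -1 * ((i : ℝ) + 1) ^ 2 + 0 * ((i : ℝ) + 1) ^ 3 =
      ((j : ℝ) + 1) ^ 2 - ((i : ℝ) - j) ^ 2 := by ring
  rw [h]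
  refine ⟨by linarith [sq_nonneg ((i : ℝ) - j)], ?_⟩
  rw [sub_eq_self, sq_eq_zero_iff, sub_eq_zero, Nat.cast_inj]

theorem isExposed_curvePoint {A : Set ℕ} {j : ℕ} (hj : j ∈ A) :
    IsExposed ℝ (convexHull ℝ (curvePoint '' A)) {curvePoint j} := by
  obtain ⟨l, c, hl⟩ := exists_functional_lt j
  have h : curvePoint '' A ∩ {x | l x = c} = {curvePoint j} := by
    ext x
    constructor
    · rintro ⟨⟨i, hi, rfl⟩, hx⟩
      rw [(hl i).2.1 hx]
      rfl
    · rintro rfl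
      exact ⟨⟨j, hj, rfl⟩, (hl j).2.2 rfl⟩
  have h' := isExposed_convexHull_inter (S := curvePoint '' A) l (c := c) (by
    rintro _ ⟨i, -, rfl⟩
    exact (hl i).1)
  rwa [h, convexHull_singleton] at h'

theorem curvePoint_mem_convexHull {A : Set ℕ} {j : ℕ} :
    curvePoint j ∈ convexHull ℝ (curvePoint '' A) ↔ j ∈ A := by
  refine ⟨fun h => ?_, fun h => subset_convexHull ℝ _ ⟨j, h, rfl⟩⟩
  obtain ⟨l, c, hl⟩ := exists_functional_lt j
  have h' : curvePoint j ∈ convexHull ℝ (curvePoint '' A) ∩ {x | l x = c} :=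
    ⟨h, (hl j).2.2 rfl⟩
  rw [convexHull_inter_eq l (by rintro _ ⟨i, -, rfl⟩; exact (hl i).1)] at h'
  obtain ⟨_, ⟨i, hi, rfl⟩, hx⟩ := convexHull_nonempty_iff.1 ⟨_, h'⟩
  rwa [← (hl i).2.1 hx]

/-- On the curve, `l - c` is a polynomial of degree at most 3 with four roots. This makes hulls of
four or more curve points full-dimensional. -/
theorem eq_zero_of_constant_on_curve {A : Finset ℕ} (hA : 4 ≤ A.card)
    (l : EuclideanSpace ℝ (Fin 3) →ₗ[ℝ] ℝ) (c : ℝ) (h : ∀ j ∈ A, l (curvePoint j) = c) : l = 0 := by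
  classical
  let e : Fin 3 → EuclideanSpace ℝ (Fin 3) := fun i => EuclideanSpace.single i 1
  have hx : ∀ x, l x = l (e 0) * x 0 + l (e 1) * x 1 + l (e 2) * x 2 := by
    intro x
    have : x = x 0 • e 0 + x 1 • e 1 + x 2 • e 2 := by
      ext i
      fin_cases i <;> simp [e]
    conv_lhs => rw [this]
    simp only [map_add, map_smul, smul_eq_mul]
    ring
  let p : Polynomial ℝ := Polynomial.C (l (e 2)) * Polynomial.X ^ 3 +
    Polynomial.C (l (e 1)) * Polynomial.X ^ 2 + Polynomial.C (l (e 0)) * Polynomial.X +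
    Polynomial.C (-c)
  have hp : p = 0 := by
    refine Polynomial.eq_zero_of_natDegree_lt_card_of_eval_eq_zero' p
      (A.image fun j : ℕ => (j : ℝ) + 1) ?_ ?_
    · intro t ht
      obtain ⟨j, hj, rfl⟩ := Finset.mem_image.1 ht
      have := h j hj
      rw [hx] at this
      simp [curvePoint_apply] at this
      simp [p]
      linarith
    · rw [Finset.card_image_of_injective _ (fun i j hij => by simpa using hij)]
      exact (Polynomial.natDegree_cubic_le).trans_lt hA
  have h3 : l (e 2) = 0 := by
    simpa [p, Polynomial.coeff_X, Polynomial.coeff_C] using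
      congrArg (fun q => Polynomial.coeff q 3) hp
  have h2 : l (e 1) = 0 := by
    simpa [p, Polynomial.coeff_X, Polynomial.coeff_C] using
      congrArg (fun q => Polynomial.coeff q 2) hp
  have h1 : l (e 0) = 0 := by
    simpa [p, Polynomial.coeff_X, Polynomial.coeff_C] using
      congrArg (fun q => Polynomial.coeff q 1) hp
  ext x
  rw [hx, h1, h2, h3]
  simp

theorem hasPolytopeDim_curvePolytope {A : Finset ℕ} (hA : 4 ≤ A.card) :
    HasPolytopeDim (convexHull ℝ (curvePoint '' (A : Set ℕ))) 3 := by
  obtain ⟨j₀, hj₀⟩ : A.Nonempty := Finset.card_pos.1 (by omega)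
  have hmem : ∀ j ∈ A, curvePoint j ∈ convexHull ℝ (curvePoint '' (A : Set ℕ)) := fun j hj =>
    curvePoint_mem_convexHull.2 hj
  refine ⟨⟨_, hmem j₀ hj₀⟩, ?_⟩
  have htop : vectorSpan ℝ (convexHull ℝ (curvePoint '' (A : Set ℕ))) = ⊤ := by
    by_contra hne
    obtain ⟨l, hl, hle⟩ := Submodule.exists_le_ker_of_lt_top _ (lt_top_iff_ne_top.2 hne)
    refine hl (eq_zero_of_constant_on_curve hA l (l (curvePoint j₀)) fun j hj => ?_)
    have := hle (vsub_mem_vectorSpan ℝ (hmem j hj) (hmem j₀ hj₀))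
    rwa [LinearMap.mem_ker, vsub_eq_sub, map_sub, sub_eq_zero] at this
  rw [htop, finrank_top, finrank_euclideanSpace_fin]

/-- A functional constant on a full-dimensional set vanishes, so it exposes all of `P`.
Full-dimensional members of the complex are therefore row polytopes and not proper faces. -/
theorem IsExposed.eq_of_hasPolytopeDim {d : ℕ} {P F : Set (EuclideanSpace ℝ (Fin d))}
    (h : IsExposed ℝ P F) (hF : HasPolytopeDim F d) : F = P := by
  obtain ⟨l, c, hl, hFeq⟩ := h.exists_functional hF.1
  have htop : vectorSpan ℝ F = ⊤ := by
    apply Submodule.eq_top_of_finrank_eq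
    rw [hF.2, finrank_euclideanSpace_fin]
  have hker : vectorSpan ℝ F ≤ LinearMap.ker l.toLinearMap := by
    rw [vectorSpan_def, Submodule.span_le]
    rintro _ ⟨x, hx, y, hy, rfl⟩
    rw [hFeq] at hx hy
    have hx' : l x = c := hx.2
    have hy' : l y = c := hy.2
    simp [hx', hy']
  have hl0 : ∀ x, l x = 0 := fun x => hker (htop ▸ Submodule.mem_top)
  obtain ⟨z, hz⟩ := hF.1
  rw [hFeq] at hz
  have hc : l z = c := hz.2
  rw [hFeq, Set.inter_eq_left]
  intro x _
  rw [Set.mem_ofPred_eq, hl0, ← hc, hl0]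

theorem subsingleton_of_hasPolytopeDim_zero {d : ℕ} {P : Set (EuclideanSpace ℝ (Fin d))}
    (h : HasPolytopeDim P 0) : P.Subsingleton := by
  intro x hx y hy
  have h0 : vectorSpan ℝ P = ⊥ := Submodule.finrank_eq_zero.1 h.2
  have := vsub_mem_vectorSpan ℝ hx hy
  rwa [h0, Submodule.mem_bot, vsub_eq_zero_iff_eq] at this

theorem hasPolytopeDim_singleton {d : ℕ} (x : EuclideanSpace ℝ (Fin d)) :
    HasPolytopeDim {x} 0 := by
  refine ⟨Set.singleton_nonempty x, ?_⟩
  rw [vectorSpan_singleton, finrank_bot]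

end MomentCurve

/-! ### The complex of an avoiding matrix -/

section RowComplex

variable {n : ℕ} (M : Matrix (Fin n) (Fin n) Bool)

/-- The indices of the ones in row `i`. -/
def rowSupport (i : Fin n) : Finset ℕ :=
  (Finset.univ.filter fun j : Fin n => M i j = true).map Fin.valEmbedding

theorem card_rowSupport (i : Fin n) : (rowSupport M i).card = rowWeight M i :=
  Finset.card_map _

theorem val_mem_rowSupport {i j : Fin n} : (j : ℕ) ∈ rowSupport M i ↔ M i j = true := by
  simp [rowSupport, Fin.val_inj]

theorem exists_of_mem_rowSupport {i : Fin n} {j : ℕ} (hj : j ∈ rowSupport M i) :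
    ∃ j' : Fin n, j = j' ∧ M i j' = true := by
  simp only [rowSupport, Finset.mem_map, Finset.mem_filter, Finset.mem_univ, true_and] at hj
  obtain ⟨j', h, rfl⟩ := hj
  exact ⟨j', rfl, h⟩

theorem rowPolytope_eq (i : Fin n) :
    rowPolytope M i = convexHull ℝ (curvePoint '' (rowSupport M i : Set ℕ)) := by
  rw [rowPolytope, rowSupport, Finset.coe_map, Set.image_image]
  simp [curvePoint]

theorem finite_curvePoint_rowSupport (i : Fin n) :
    (curvePoint '' (rowSupport M i : Set ℕ)).Finite :=
  (Finset.finite_toSet _).image _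

variable {M}

theorem rowSupport_not_alternating (hM : ¬ MatrixContains M alternatingPattern) {i i' : Fin n}
    (hi : i < i') : ∀ b₀ ∈ (rowSupport M i' : Set ℕ), ∀ a₁ ∈ (rowSupport M i : Set ℕ),
      ∀ b₂ ∈ (rowSupport M i' : Set ℕ), ∀ a₃ ∈ (rowSupport M i : Set ℕ),
      b₀ < a₁ → a₁ < b₂ → ¬ b₂ < a₃ := by
  intro b₀ h₀ a₁ h₁ b₂ h₂ a₃ h₃ l₀ l₁ l₂
  obtain ⟨b₀, rfl, h₀⟩ := exists_of_mem_rowSupport M h₀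
  obtain ⟨a₁, rfl, h₁⟩ := exists_of_mem_rowSupport M h₁
  obtain ⟨b₂, rfl, h₂⟩ := exists_of_mem_rowSupport M h₂
  obtain ⟨a₃, rfl, h₃⟩ := exists_of_mem_rowSupport M h₃
  refine hM ⟨OrderEmbedding.ofStrictMono ![i, i'] ?_,
    OrderEmbedding.ofStrictMono ![b₀, a₁, b₂, a₃] ?_, ?_⟩
  · rw [Fin.strictMono_iff_lt_succ]
    intro k
    fin_cases k
    exact hi
  · rw [Fin.strictMono_iff_lt_succ]
    intro k
    fin_cases k
    exacts [l₀, l₁, l₂]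
  · intro r c hrc
    fin_cases r <;> fin_cases c <;> first | exact absurd hrc (by decide) | assumption

theorem isExposed_rowPolytope_inter (hM : ¬ MatrixContains M alternatingPattern) (i i' : Fin n) :
    IsExposed ℝ (rowPolytope M i) (rowPolytope M i ∩ rowPolytope M i') := by
  have hlt : ∀ i : Fin n, ∀ a ∈ (rowSupport M i : Set ℕ), a < n := by
    intro i a ha
    obtain ⟨j, rfl, -⟩ := exists_of_mem_rowSupport M ha
    exact j.2
  rw [rowPolytope_eq, rowPolytope_eq]
  rcases lt_trichotomy i i' with h | rfl | h
  · exact (isExposed_curvePolytope_inter (hlt i) (hlt i') (rowSupport_not_alternating hM h)).1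
  · rw [Set.inter_self]
  · rw [Set.inter_comm]
    exact (isExposed_curvePolytope_inter (hlt i') (hlt i) (rowSupport_not_alternating hM h)).2

theorem rowPolytope_inter_faces (hM : ¬ MatrixContains M alternatingPattern) {i i' : Fin n}
    {F F' : Set (EuclideanSpace ℝ (Fin 3))} (hF : IsExposed ℝ (rowPolytope M i) F)
    (hF' : IsExposed ℝ (rowPolytope M i') F') : IsExposed ℝ F (F ∩ F') := by
  have h := isExposed_rowPolytope_inter hM i i'
  have h' := isExposed_rowPolytope_inter hM i' i
  rw [Set.inter_comm] at h'
  rw [rowPolytope_eq M i] at h h' hF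
  rw [rowPolytope_eq M i'] at h h' hF'
  exact IsExposed.inter_of_inter (finite_curvePoint_rowSupport M i) h h' hF hF'

/-- The polytopal complex of a matrix that avoids the alternating pattern. -/
def rowComplex (hM : ¬ MatrixContains M alternatingPattern) (hn : ∃ i, 4 ≤ rowWeight M i) :
    PolytopalComplex 3 where
  faces := {F | ∃ i : Fin n, 4 ≤ rowWeight M i ∧ IsPolytopeFace (rowPolytope M i) F}
  finite_faces := by
    refine Set.Finite.subset (((Set.finite_lt_nat n).image curvePoint).powerset.image
      (fun s => convexHull ℝ s)) ?_
    rintro F ⟨i, -, hF⟩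
    rw [IsPolytopeFace, rowPolytope_eq] at hF
    refine ⟨_, ?_, hF.eq_convexHull.symm⟩
    rintro _ ⟨⟨j, hj, rfl⟩, -⟩
    obtain ⟨j, rfl, -⟩ := exists_of_mem_rowSupport M hj
    exact ⟨j, j.2, rfl⟩
  isPolytope := by
    rintro F ⟨i, -, hF⟩
    rw [IsPolytopeFace, rowPolytope_eq] at hF
    refine ⟨((finite_curvePoint_rowSupport M i).inter_of_left F).toFinset, ?_⟩
    rw [Set.Finite.coe_toFinset]
    exact hF.eq_convexHull
  empty_mem := by
    obtain ⟨i, hi⟩ := hn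
    exact ⟨i, hi, isExposed_empty⟩
  face_mem := by
    rintro P ⟨i, hi, hP⟩ F hF
    refine ⟨i, hi, ?_⟩
    rw [IsPolytopeFace, rowPolytope_eq] at hP ⊢
    exact hP.trans_convexHull (finite_curvePoint_rowSupport M i) hF
  inter_isFace := by
    rintro P ⟨i, -, hP⟩ P' ⟨i', -, hP'⟩
    refine ⟨rowPolytope_inter_faces hM hP hP', ?_⟩
    rw [Set.inter_comm]
    exact rowPolytope_inter_faces hM hP' hP

variable (hM : ¬ MatrixContains M alternatingPattern) (hn : ∃ i, 4 ≤ rowWeight M i)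

theorem kFaces_three_rowComplex :
    (rowComplex hM hn).kFaces 3 = rowPolytope M '' {i | 4 ≤ rowWeight M i} := by
  ext F
  constructor
  · rintro ⟨⟨i, hi, hF⟩, hdim⟩
    exact ⟨i, hi, (IsExposed.eq_of_hasPolytopeDim hF hdim).symm⟩
  · rintro ⟨i, hi, rfl⟩
    refine ⟨⟨i, hi, IsExposed.refl (𝕜 := ℝ) _⟩, ?_⟩
    rw [rowPolytope_eq]
    exact hasPolytopeDim_curvePolytope (by rwa [card_rowSupport])

theorem kFaces_zero_rowComplex : (rowComplex hM hn).kFaces 0 =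
    (fun j : Fin n => {curvePoint j}) '' {j | ∃ i, 4 ≤ rowWeight M i ∧ M i j = true} := by
  ext F
  constructor
  · rintro ⟨⟨i, hi, hF⟩, hdim⟩
    rw [IsPolytopeFace, rowPolytope_eq] at hF
    have hne := hdim.1
    rw [hF.eq_convexHull] at hne
    obtain ⟨_, ⟨j, hj, rfl⟩, hjF⟩ := convexHull_nonempty_iff.1 hne
    obtain ⟨j, rfl, hij⟩ := exists_of_mem_rowSupport M hj
    exact ⟨j, ⟨i, hi, hij⟩,
      ((subsingleton_of_hasPolytopeDim_zero hdim).eq_singleton_of_mem hjF).symm⟩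
  · rintro ⟨j, ⟨i, hi, hj⟩, rfl⟩
    refine ⟨⟨i, hi, ?_⟩, hasPolytopeDim_singleton _⟩
    rw [IsPolytopeFace, rowPolytope_eq]
    exact isExposed_curvePoint ((val_mem_rowSupport M).2 hj)

theorem curvePoint_mem_rowPolytope {i j : Fin n} :
    curvePoint j ∈ rowPolytope M i ↔ M i j = true := by
  rw [rowPolytope_eq, curvePoint_mem_convexHull, Finset.mem_coe, val_mem_rowSupport]

/-- The polytope determines the support of its row, and two equal rows with four ones already
contain the pattern. -/
theorem injOn_rowPolytope (hM : ¬ MatrixContains M alternatingPattern) :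
    Set.InjOn (rowPolytope M) {i | 4 ≤ rowWeight M i} := by
  have key : ∀ i i', 4 ≤ rowWeight M i → i < i' → rowPolytope M i ≠ rowPolytope M i' := by
    intro i i' hi hlt heq
    have hsub : ∀ j ∈ rowSupport M i, j ∈ (rowSupport M i' : Set ℕ) := by
      intro j hj
      rw [← curvePoint_mem_convexHull, ← rowPolytope_eq, ← heq, rowPolytope_eq,
        curvePoint_mem_convexHull]
      exact hj
    rw [← card_rowSupport] at hi
    obtain ⟨t, ht, hcard⟩ := Finset.exists_subset_card_eq hi
    let e := t.orderEmbOfFin hcard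
    have he : ∀ k, e k ∈ rowSupport M i := fun k => ht (t.orderEmbOfFin_mem hcard k)
    exact rowSupport_not_alternating hM hlt _ (hsub _ (he 0)) _ (he 1) _ (hsub _ (he 2)) _ (he 3)
      (e.strictMono (by decide)) (e.strictMono (by decide)) (e.strictMono (by decide))
  intro i hi i' hi' heq
  rcases lt_trichotomy i i' with h | h | h
  · exact absurd heq (key i i' hi h)
  · exact h
  · exact absurd heq.symm (key i' i hi' h)

theorem bijOn_rowPolytope :
    Set.BijOn (rowPolytope M) {i | 4 ≤ rowWeight M i} ((rowComplex hM hn).kFaces 3) := by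
  rw [kFaces_three_rowComplex]
  exact (injOn_rowPolytope hM).bijOn_image

theorem fNum_zero_rowComplex_le : (rowComplex hM hn).fNum 0 ≤ n := by
  rw [PolytopalComplex.fNum, kFaces_zero_rowComplex]
  exact (Set.ncard_image_le (Set.toFinite _)).trans ((Set.ncard_le_card _).trans_eq (by simp))

theorem fNum_three_rowComplex_le : (rowComplex hM hn).fNum 3 ≤ n := by
  rw [PolytopalComplex.fNum, kFaces_three_rowComplex]
  exact (Set.ncard_image_le (Set.toFinite _)).trans ((Set.ncard_le_card _).trans_eq (by simp))

theorem fNum_three_rowComplex (hrow : ∀ i, 4 ≤ rowWeight M i) : (rowComplex hM hn).fNum 3 = n := by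
  rw [PolytopalComplex.fNum, kFaces_three_rowComplex, (injOn_rowPolytope hM).ncard_image]
  simp [hrow]

theorem vertexFacetIncidences_rowComplex (hrow : ∀ i, 4 ≤ rowWeight M i) :
    (rowComplex hM hn).vertexFacetIncidences = matrixWeight M := by
  have h : {p : Set (EuclideanSpace ℝ (Fin 3)) × Set (EuclideanSpace ℝ (Fin 3)) |
      p.1 ∈ (rowComplex hM hn).kFaces 0 ∧ p.2 ∈ (rowComplex hM hn).kFaces 3 ∧ p.1 ⊆ p.2} =
      (fun q : Fin n × Fin n => ({curvePoint q.2}, rowPolytope M q.1)) ''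
        {q | M q.1 q.2 = true} := by
    ext ⟨F, P⟩
    rw [Set.mem_ofPred_eq, kFaces_zero_rowComplex, kFaces_three_rowComplex]
    constructor
    · rintro ⟨⟨j, -, rfl⟩, ⟨i, -, rfl⟩, h⟩
      exact ⟨(i, j), curvePoint_mem_rowPolytope.1 (Set.singleton_subset_iff.1 h), rfl⟩
    · rintro ⟨⟨i, j⟩, hij, h⟩
      obtain ⟨rfl, rfl⟩ := Prod.ext_iff.1 h
      exact ⟨⟨j, ⟨i, hrow i, hij⟩, rfl⟩, ⟨i, hrow i, rfl⟩,
        Set.singleton_subset_iff.2 (curvePoint_mem_rowPolytope.2 hij)⟩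
  rw [PolytopalComplex.vertexFacetIncidences, h, Set.ncard_image_of_injective, matrixWeight,
    ← Set.ncard_coe_finset]
  · simp
  · rintro ⟨i, j⟩ ⟨i', j'⟩ h
    obtain ⟨h1, h2⟩ := Prod.ext_iff.1 h
    exact Prod.ext (injOn_rowPolytope hM (hrow i) (hrow i') h2)
      (Fin.val_injective (curvePoint_injective (Set.singleton_injective h1)))

end RowComplex

/-! ### Choice of parameters -/

theorem mainTheorem8 :
    ∃ c C : ℝ, 0 < c ∧ 0 < C ∧ ∀ (n₀ : ℕ) (K : ℝ), ∃ n : ℕ, n₀ ≤ n ∧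
      ∃ (M : Matrix (Fin n) (Fin n) Bool) (Q : PolytopalComplex 3),
        -- the matrix avoids the pattern and has weight `Θ(n α(n))`
        ¬ MatrixContains M alternatingPattern ∧
        c * ((n : ℝ) * (inverseAckermann n : ℝ)) ≤ (matrixWeight M : ℝ) ∧
        (matrixWeight M : ℝ) ≤ C * ((n : ℝ) * (inverseAckermann n : ℝ)) ∧
        -- `Q` consists of the polytopes of the rows with at least four ones, and their faces
        Q.faces = {F | ∃ i : Fin n, 4 ≤ rowWeight M i ∧ IsPolytopeFace (rowPolytope M i) F} ∧
        -- these polytopes are the facets of `Q`, one for each such row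
        Set.BijOn (rowPolytope M) {i : Fin n | 4 ≤ rowWeight M i} (Q.kFaces 3) ∧
        -- `f_0, f_3 ≤ n` and `f_{03} = Θ(n α(n))`
        Q.fNum 0 ≤ n ∧
        Q.fNum 3 ≤ n ∧
        c * ((n : ℝ) * (inverseAckermann n : ℝ)) ≤ (Q.vertexFacetIncidences : ℝ) ∧
        (Q.vertexFacetIncidences : ℝ) ≤ C * ((n : ℝ) * (inverseAckermann n : ℝ)) ∧
        -- the complexity is unbounded
        K < Q.complexity := by
  refine ⟨1 / 2, 1, by norm_num, by norm_num, fun n₀ K => ?_⟩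
  obtain ⟨L, hL⟩ := exists_nat_gt K
  -- This makes the row weight at least `2 * L + 4`. As `f₀ + f₃ ≤ 2n`, the numerator of the
  -- complexity then exceeds `L` times its denominator once `4n > 20`.
  obtain ⟨n₁, hn₁⟩ := exists_le_inverseAckermann (4 * L + 8)
  -- Since `k + 1 ≤ n`, this gives `n ≥ n₀`, `n ≥ n₁` and `n ≥ 11`; the last keeps the denominator
  -- positive.
  obtain ⟨k, hk⟩ : ∃ k, k = n₀ + n₁ + 10 := ⟨_, rfl⟩
  have hkn := le_mul_fanCount k
  have hα := hn₁ k (by omega) (by omega)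
  have hα' := inverseAckermann_mul_fanCount_le k (by omega)
  -- Half of the inverse Ackermann value, rounded up; it is at most `k + 1` because that value is at
  -- most `2 * k + 1`.
  generalize hw : (inverseAckermann (4 * fanCount k 4) + 1) / 2 = w at *
  obtain ⟨M, hM, hrow⟩ := exists_avoiding_matrix_rowWeight_eq k w (by omega)
  generalize 4 * fanCount k 4 = n at *
  have hrow' : ∀ i, 4 ≤ rowWeight M i := fun i => by rw [hrow]; omega
  have hweight : matrixWeight M = n * w := by
    rw [matrixWeight_eq_sum, Finset.sum_const_nat fun i _ => hrow i, Finset.card_univ,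
      Fintype.card_fin]
  have hex : ∃ i, 4 ≤ rowWeight M i := ⟨⟨0, by omega⟩, hrow' _⟩
  have hlower : 1 / 2 * ((n : ℝ) * inverseAckermann n) ≤ ((n * w : ℕ) : ℝ) := by
    have : (inverseAckermann n : ℝ) ≤ 2 * w := by
      exact_mod_cast (by omega : inverseAckermann n ≤ 2 * w)
    have := mul_le_mul_of_nonneg_left this (Nat.cast_nonneg (α := ℝ) n)
    push_cast
    linarith
  have hupper : ((n * w : ℕ) : ℝ) ≤ 1 * ((n : ℝ) * inverseAckermann n) := by
    rw [one_mul]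
    exact_mod_cast Nat.mul_le_mul_left n (by omega : w ≤ inverseAckermann n)
  have hinc := vertexFacetIncidences_rowComplex hM hex hrow'
  refine ⟨n, by omega, M, rowComplex hM hex, hM, ?_, ?_, rfl, bijOn_rowPolytope hM hex,
    fNum_zero_rowComplex_le hM hex, fNum_three_rowComplex_le hM hex, ?_, ?_, ?_⟩
  · rwa [hweight]
  · rwa [hweight]
  · rwa [hinc, hweight]
  · rwa [hinc, hweight]
  · rw [PolytopalComplex.complexity, hinc, hweight, fNum_three_rowComplex hM hex hrow']
    have h0 : ((rowComplex hM hex).fNum 0 : ℝ) ≤ n := by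
      exact_mod_cast fNum_zero_rowComplex_le hM hex
    have h0' : (0 : ℝ) ≤ (rowComplex hM hex).fNum 0 := Nat.cast_nonneg _
    have hn : (11 : ℝ) ≤ n := by exact_mod_cast (by omega : 11 ≤ n)
    have hwL : (2 * L + 4 : ℝ) ≤ w := by exact_mod_cast (by omega : 2 * L + 4 ≤ w)
    refine hL.trans ?_
    rw [lt_div_iff₀ (by linarith)]
    have h1 : (L : ℝ) * ((rowComplex hM hex).fNum 0 + n - 10) ≤ L * (2 * n) :=
      mul_le_mul_of_nonneg_left (by linarith) (Nat.cast_nonneg _)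
    have h2 : (n : ℝ) * (2 * L + 4) ≤ n * w := mul_le_mul_of_nonneg_left hwL (by linarith)
    push_cast
    linarith
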